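/- Let $\mathbb D=\{z\in\mathbb C:|z|<1\}$, identified with the open unit disk of $\mathbb R^2$, let $H_0^1(\mathbb D)$ be the real Sobolev space obtained as the closure of $C_c^\infty(\mathbb D)$ (real-valued functions) in the $H^1$ norm, let $$\eta_\zeta(z)=\frac{z-\zeta}{1-\bar\zeta z}\qquad(\zeta\in\mathbb D),$$ and let $$J(u)=\int_{\mathbb D}\frac{e^{4\pi u^2}-1}{(1-|x|^2)^2}\,dx .$$ Then: 1. $J(u)<\infty$ for every $u\in H_0^1(\mathbb D)$. 2. $J$ is Möbius-invariant: for all $\zeta\in\mathbb D$ and $u\in H_0^1(\mathbb D)$ one has $u\circ\eta_\zeta\in H_0^1(\mathbb D)$ and $J(u\circ\eta_\zeta)=J(u)$. 3. $J$ is not weakly continuous at any point of $H_0^1(\mathbb D)$: for every $u\in H_0^1(\mathbb D)$, $J$ is not weakly sequentially continuous at $u$, and hence not continuous at $u$ in the weak topology. 4. More precisely, let $w\in C_c^\infty(\mathbb D)$, $w\ne0$, and let $(\zeta_k)$ be any sequence in $\mathbb D$ with $\zeta_k\to1$. Then $w\circ\eta_{\zeta_k}\in H_0^1(\mathbb D)$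 for all $k$, and for every $u\in H_0^1(\mathbb D)$ the functions $u_k=u+w\circ\eta_{\zeta_k}$ satisfy $$u_k\rightharpoonup u\ \text{ weakly in } H_0^1(\mathbb D),\qquad J(u_k)\to J(u)+J(w)\neq J(u).$$ -/

import Mathlib

open Filter Topology MeasureTheory
open scoped ComplexConjugate ContDiff Gradient Distributions

noncomputable section

namespace MobiusTM

/-- The open unit disk `𝔻 ⊆ ℂ = ℝ²`. -/
def disk : TopologicalSpace.Opens ℂ := ⟨Metric.ball 0 1, Metric.isOpen_ball⟩

/-- Lebesgue measure on the disk. -/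
abbrev diskMeasure : Measure ℂ := volume.restrict (disk : Set ℂ)

/-- `L²(𝔻) × L²(𝔻; ℝ²)` with the Hilbert norm `(‖u‖₂² + ‖g‖₂²)^(1/2)`.  The pair `(u, ∇u)` has in it
the `H¹(𝔻)` norm of `u`; the values of a gradient lie in `ℝ²`, which is `ℂ` with its real inner
product `Re (conj a * b)`. -/
abbrev PairSpace : Type := WithLp 2 (Lp ℝ 2 diskMeasure × Lp ℂ 2 diskMeasure)

theorem testFunction_memLp (φ : 𝓓(disk, ℝ)) : MemLp φ 2 diskMeasure :=
  (φ.continuous.memLp_of_hasCompactSupport φ.hasCompactSupport).restrict _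

theorem testFunction_differentiable (φ : 𝓓(disk, ℝ)) : Differentiable ℝ φ :=
  φ.contDiff.differentiable (by simp)

theorem testFunction_gradient_memLp (φ : 𝓓(disk, ℝ)) :
    MemLp (gradient (φ : ℂ → ℝ)) 2 diskMeasure := by
  have hc : Continuous (fderiv ℝ (φ : ℂ → ℝ)) := φ.contDiff.continuous_fderiv (by simp)
  have hg : Continuous (gradient (φ : ℂ → ℝ)) :=
    (InnerProductSpace.toDual ℝ ℂ).symm.continuous.comp hc
  have hs : HasCompactSupport (gradient (φ : ℂ → ℝ)) :=
    (φ.hasCompactSupport.fderiv ℝ).comp_left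
      (g := (InnerProductSpace.toDual ℝ ℂ).symm) (map_zero _)
  exact (hg.memLp_of_hasCompactSupport hs).restrict _

/-- The pair `(φ, ∇φ)` for `φ ∈ C_c^∞(𝔻)`. -/
def testPair : 𝓓(disk, ℝ) →ₗ[ℝ] PairSpace where
  toFun φ := WithLp.toLp 2
    ((testFunction_memLp φ).toLp φ, (testFunction_gradient_memLp φ).toLp (gradient φ))
  map_add' φ ψ := by
    have h : gradient (φ + ψ : 𝓓(disk, ℝ)) = gradient (φ : ℂ → ℝ) + gradient (ψ : ℂ → ℝ) := by
      ext1 z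
      have := fderiv_add (testFunction_differentiable φ z) (testFunction_differentiable ψ z)
      simp only [gradient, Pi.add_apply, ← map_add, ← this]
      rfl
    rw [← WithLp.toLp_add, Prod.mk_add_mk, ← MemLp.toLp_add, ← MemLp.toLp_add]
    simp only [h]
    rfl
  map_smul' c φ := by
    have h : gradient (c • φ : 𝓓(disk, ℝ)) = c • gradient (φ : ℂ → ℝ) := by
      ext1 z
      have := fderiv_const_smul (testFunction_differentiable φ z) c
      simp only [gradient, Pi.smul_apply, ← map_smul, ← this]
      rfl
    rw [RingHom.id_apply, ← WithLp.toLp_smul, Prod.smul_mk, ← MemLp.toLp_const_smul,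
      ← MemLp.toLp_const_smul]
    simp only [h]
    rfl

/-- The Sobolev space `H₀¹(𝔻)`, the closure of `C_c^∞(𝔻)` in the `H¹` norm: the Hilbert space of
the pairs `(u, ∇u)` that are `L²`-limits of pairs `(φ, ∇φ)` with `φ ∈ C_c^∞(𝔻)`.  Norm, inner
product and weak topology are those induced from `PairSpace`. -/
def H01 : Submodule ℝ PairSpace := (LinearMap.range testPair).topologicalClosure

/-- The function underlying an element of `H₀¹(𝔻)`, determined almost everywhere on `𝔻`. -/
def fn (u : H01) : ℂ → ℝ := ((u : PairSpace).fst : Lp ℝ 2 diskMeasure)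

/-- The Möbius transformation `η_ζ(z) = (z - ζ) / (1 - conj ζ * z)` of the disk, for `ζ ∈ 𝔻`. -/
def eta (ζ z : ℂ) : ℂ := (z - ζ) / (1 - conj ζ * z)

/-- The density `(exp (4π f²) - 1) / (1 - |z|²)²`. -/
def density (f : ℂ → ℝ) (z : ℂ) : ℝ :=
  (Real.exp (4 * Real.pi * f z ^ 2) - 1) / (1 - ‖z‖ ^ 2) ^ 2

/-- The functional `J(f) = ∫_𝔻 (exp (4π f²) - 1) / (1 - |z|²)² dz`. -/
def J (f : ℂ → ℝ) : ℝ := ∫ z in (disk : Set ℂ), density f z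

/-- Weak convergence `u_k ⇀ u` in `H₀¹(𝔻)`. -/
def WeaklyConverges (U : ℕ → H01) (u : H01) : Prop :=
  Tendsto (fun k => toWeakSpace ℝ H01 (U k)) atTop (𝓝 (toWeakSpace ℝ H01 u))

/-- Continuity of a functional at `u` with respect to the weak topology of `H₀¹(𝔻)`. -/
def WeaklyContinuousAt (F : H01 → ℝ) (u : H01) : Prop :=
  ContinuousAt (fun x : WeakSpace ℝ H01 => F ((toWeakSpace ℝ H01).symm x)) (toWeakSpace ℝ H01 u)

/-- Sequential weak continuity of a functional at `u`. -/
def WeaklySeqContinuousAt (F : H01 → ℝ) (u : H01) : Prop :=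
  ∀ U : ℕ → H01, WeaklyConverges U u → Tendsto (fun k => F (U k)) atTop (𝓝 (F u))

end MobiusTM

end

open MobiusTM

noncomputable section

namespace MobiusTM

open Set
open scoped ENNReal

/-! Everything is written in the hyperbolic area `hyp`, with density `(1 - |z|²)⁻²`. Then `J u` is
the integral of `exp (4πu²) - 1` against `hyp`, and the Dirichlet energy is the integral of the
squared hyperbolic gradient. Since `(1 - |z|²) |η'| = 1 - |η|²`, Möbius maps preserve both.

Finiteness of `J` needs no sharp Moser–Trudinger constant. An `L¹` Hardy inequality comes from the
divergence theorem, and with the Euclidean Gagliardo–Nirenberg–Sobolev inequality it gives an `L¹`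
Sobolev inequality for `hyp`. Applied to truncations of a test function over `n²` slabs of height
`1/n`, the latter bounds the area of `{φ ≥ n + 1}` by `E (K E)^(n²)`, where `E` is the energy
(`exists_measure_level_set_le`). Small energy therefore makes `exp (c φ²) - 1` integrable for any
prescribed `c`. A general `u` is a bounded test function plus a remainder of small energy, so every
`exp (c u²) - 1` is integrable (`integrable_exp_sq_sub_one`).

If `ζ_k → 1`, then `η_{ζ_k} → -1` pointwise on the disk, so the functions `w ∘ η_{ζ_k}` and their
gradients are eventually zero at each point while their norms stay bounded. Hence they tend weakly
to zero. Their supports keep a fixed hyperbolic area and leave every point, so `J` splits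
asymptotically (`tendsto_J_add_pullback`). Invariance keeps the contribution of the bump equal to `J
w > 0`, which rules out weak continuity at every `u`. -/

/-! ### Hyperbolic area on the disk -/

theorem mem_disk {z : ℂ} : z ∈ disk ↔ ‖z‖ < 1 := by
  change z ∈ Metric.ball (0 : ℂ) 1 ↔ _
  simp

theorem measurableSet_disk : MeasurableSet (disk : Set ℂ) := disk.isOpen.measurableSet

theorem one_sub_norm_sq_pos {z : ℂ} (hz : z ∈ disk) : 0 < 1 - ‖z‖ ^ 2 := by
  have h := mem_disk.1 hz
  have := norm_nonneg z
  nlinarith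

theorem one_sub_norm_sq_le_one (z : ℂ) : 1 - ‖z‖ ^ 2 ≤ 1 := by
  have := sq_nonneg ‖z‖
  linarith

theorem one_le_inv_one_sub_norm_sq {z : ℂ} (hz : z ∈ disk) : 1 ≤ (1 - ‖z‖ ^ 2)⁻¹ :=
  (one_le_inv₀ (one_sub_norm_sq_pos hz)).2 (one_sub_norm_sq_le_one z)

/-- The density of the hyperbolic area with respect to Lebesgue measure. -/
def hypWeight (z : ℂ) : ℝ := ((1 - ‖z‖ ^ 2) ^ 2)⁻¹

theorem hypWeight_nonneg (z : ℂ) : 0 ≤ hypWeight z := by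
  unfold hypWeight
  positivity

theorem one_le_hypWeight {z : ℂ} (hz : z ∈ disk) : 1 ≤ hypWeight z := by
  rw [hypWeight, ← inv_pow]
  exact one_le_pow₀ (one_le_inv_one_sub_norm_sq hz)

theorem measurable_hypWeight : Measurable hypWeight := by
  unfold hypWeight
  fun_prop

/-- The hyperbolic area of the disk, `dx / (1 - |x|²)²`. -/
def hyp : Measure ℂ := diskMeasure.withDensity fun z => ENNReal.ofReal (hypWeight z)

theorem lintegral_hyp (f : ℂ → ℝ≥0∞) :
    ∫⁻ z, f z ∂hyp = ∫⁻ z in (disk : Set ℂ), ENNReal.ofReal (hypWeight z) * f z :=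
  lintegral_withDensity_eq_lintegral_mul_non_measurable _ measurable_hypWeight.ennreal_ofReal
    (Eventually.of_forall fun _ => ENNReal.ofReal_lt_top) f

theorem integral_hyp (f : ℂ → ℝ) :
    ∫ z, f z ∂hyp = ∫ z in (disk : Set ℂ), hypWeight z * f z := by
  rw [hyp, integral_withDensity_eq_integral_toReal_smul measurable_hypWeight.ennreal_ofReal
    (Eventually.of_forall fun _ => ENNReal.ofReal_lt_top)]
  simp [ENNReal.toReal_ofReal (hypWeight_nonneg _)]

theorem integrable_hyp_iff {f : ℂ → ℝ} :
    Integrable f hyp ↔ IntegrableOn (fun z => hypWeight z * f z) (disk : Set ℂ) := by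
  rw [hyp, integrable_withDensity_iff_integrable_smul' measurable_hypWeight.ennreal_ofReal
    (Eventually.of_forall fun _ => ENNReal.ofReal_lt_top)]
  simp [IntegrableOn, ENNReal.toReal_ofReal (hypWeight_nonneg _)]

theorem hyp_absolutelyContinuous : hyp ≪ diskMeasure := withDensity_absolutelyContinuous _ _

theorem absolutelyContinuous_hyp : diskMeasure ≪ hyp := by
  refine withDensity_absolutelyContinuous' measurable_hypWeight.ennreal_ofReal.aemeasurable ?_
  filter_upwards [ae_restrict_mem measurableSet_disk] with z hz
  simpa using lt_of_lt_of_le one_pos (one_le_hypWeight hz)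

theorem ae_hyp_mem_disk : ∀ᵐ z ∂hyp, z ∈ disk :=
  hyp_absolutelyContinuous.ae_le (ae_restrict_mem measurableSet_disk)

theorem lintegral_disk_le_lintegral_hyp (f : ℂ → ℝ≥0∞) :
    ∫⁻ z in (disk : Set ℂ), f z ≤ ∫⁻ z, f z ∂hyp := by
  rw [lintegral_hyp]
  refine setLIntegral_mono' measurableSet_disk fun z hz => ?_
  refine le_mul_of_one_le_left' ?_
  simpa using one_le_hypWeight hz

theorem J_eq_integral_hyp (f : ℂ → ℝ) :
    J f = ∫ z, (Real.exp (4 * Real.pi * f z ^ 2) - 1) ∂hyp := by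
  rw [integral_hyp]
  simp [J, density, hypWeight, div_eq_inv_mul]

/-! ### The Möbius transformations -/

section eta

variable {ζ z : ℂ}

theorem norm_conj_mul_lt_one (hζ : ζ ∈ disk) (hz : z ∈ disk) : ‖conj ζ * z‖ < 1 := by
  rw [norm_mul, RCLike.norm_conj]
  exact mul_lt_one_of_nonneg_of_lt_one_left (norm_nonneg _) (mem_disk.1 hζ) (mem_disk.1 hz).le

theorem one_sub_conj_mul_ne_zero (hζ : ζ ∈ disk) (hz : z ∈ disk) : 1 - conj ζ * z ≠ 0 := by
  intro h
  have := norm_conj_mul_lt_one hζ hz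
  rw [← sub_eq_zero.1 h] at this
  simp at this

theorem one_sub_norm_eta_sq (hζ : ζ ∈ disk) (hz : z ∈ disk) :
    1 - ‖eta ζ z‖ ^ 2 = (1 - ‖ζ‖ ^ 2) * (1 - ‖z‖ ^ 2) / ‖1 - conj ζ * z‖ ^ 2 := by
  have h : ‖1 - conj ζ * z‖ ^ 2 ≠ 0 := by simpa using one_sub_conj_mul_ne_zero hζ hz
  rw [eta, norm_div, div_pow, eq_div_iff h, sub_mul, div_mul_cancel₀ _ h]
  simp only [← Complex.normSq_eq_norm_sq, Complex.normSq_apply]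
  simp
  ring

theorem eta_mem_disk (hζ : ζ ∈ disk) (hz : z ∈ disk) : eta ζ z ∈ disk := by
  have h : 0 < ‖1 - conj ζ * z‖ ^ 2 := by
    have := norm_pos_iff.2 (one_sub_conj_mul_ne_zero hζ hz)
    positivity
  have h1 : 0 < 1 - ‖eta ζ z‖ ^ 2 := by
    rw [one_sub_norm_eta_sq hζ hz]
    have := one_sub_norm_sq_pos hζ
    have := one_sub_norm_sq_pos hz
    positivity
  rw [mem_disk]
  nlinarith [norm_nonneg (eta ζ z)]

theorem neg_mem_disk (hζ : ζ ∈ disk) : -ζ ∈ disk := by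
  rw [mem_disk] at *
  simpa

theorem eta_neg_eta (hζ : ζ ∈ disk) (hz : z ∈ disk) : eta (-ζ) (eta ζ z) = z := by
  have h := one_sub_conj_mul_ne_zero hζ hz
  have h1 : 1 - conj (-ζ) * eta ζ z ≠ 0 :=
    one_sub_conj_mul_ne_zero (neg_mem_disk hζ) (eta_mem_disk hζ hz)
  have h2 : eta (-ζ) (eta ζ z) * (1 - conj (-ζ) * eta ζ z) = eta ζ z - -ζ := by
    rw [eta, div_mul_cancel₀ _ h1]
  have h3 : eta ζ z - -ζ = z * (1 - conj (-ζ) * eta ζ z) := by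
    have h4 : eta ζ z * (1 - conj ζ * z) = z - ζ := by rw [eta, div_mul_cancel₀ _ h]
    simp only [map_neg]
    linear_combination h4
  exact mul_right_cancel₀ h1 (h2.trans h3)

theorem eta_eta_neg (hζ : ζ ∈ disk) (hz : z ∈ disk) : eta ζ (eta (-ζ) z) = z := by
  simpa using eta_neg_eta (neg_mem_disk hζ) hz

theorem hasDerivAt_eta (hζ : ζ ∈ disk) (hz : z ∈ disk) :
    HasDerivAt (eta ζ) (((1 - ‖ζ‖ ^ 2 : ℝ) : ℂ) / (1 - conj ζ * z) ^ 2) z := by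
  have h := one_sub_conj_mul_ne_zero hζ hz
  have h1 : HasDerivAt (fun z => z - ζ) 1 z := (hasDerivAt_id z).sub_const ζ
  have h2 : HasDerivAt (fun z => 1 - conj ζ * z) (-conj ζ) z := by
    simpa using ((hasDerivAt_id z).const_mul (conj ζ)).const_sub 1
  have h3 : ((1 - ‖ζ‖ ^ 2 : ℝ) : ℂ) = 1 * (1 - conj ζ * z) - (z - ζ) * -conj ζ := by
    push_cast
    rw [← Complex.mul_conj']
    ring
  rw [h3]
  exact h1.div h2 h

/-- The complex derivative of `eta ζ` on the disk. -/
def etaDeriv (ζ z : ℂ) : ℂ := ((1 - ‖ζ‖ ^ 2 : ℝ) : ℂ) / (1 - conj ζ * z) ^ 2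

/-- Infinitesimal isometry for the metric `|dz| / (1 - |z|²)`. Invariance of the area and of the
gradient both rest on this identity. -/
theorem norm_etaDeriv_mul (hζ : ζ ∈ disk) (hz : z ∈ disk) :
    ‖etaDeriv ζ z‖ * (1 - ‖z‖ ^ 2) = 1 - ‖eta ζ z‖ ^ 2 := by
  rw [one_sub_norm_eta_sq hζ hz, etaDeriv, norm_div, norm_pow, Complex.norm_real,
    Real.norm_of_nonneg (one_sub_norm_sq_pos hζ).le]
  ring

theorem measurable_eta (ζ : ℂ) : Measurable (eta ζ) := by
  unfold eta
  fun_prop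

theorem contDiffAt_eta (hζ : ζ ∈ disk) (hz : z ∈ disk) : ContDiffAt ℝ ∞ (eta ζ) z := by
  have h1 : ContDiffAt ℝ ∞ (fun z => z - ζ) z := by fun_prop
  have h2 : ContDiffAt ℝ ∞ (fun z => 1 - conj ζ * z) z := by fun_prop
  exact (h1.mul (h2.inv (one_sub_conj_mul_ne_zero hζ hz))).congr_of_eventuallyEq
    (Eventually.of_forall fun _ => div_eq_mul_inv _ _)

/-- The real determinant of multiplication by `c` is the algebra norm of `c` from `ℂ` to `ℝ`. -/
theorem det_smul_one (c : ℂ) : (c • (1 : ℂ →L[ℝ] ℂ)).det = ‖c‖ ^ 2 := by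
  rw [← Complex.normSq_eq_norm_sq, ← Algebra.norm_complex_apply, Algebra.norm_apply]
  rfl

theorem hasFDerivAt_eta (hζ : ζ ∈ disk) (hz : z ∈ disk) :
    HasFDerivAt (eta ζ) (etaDeriv ζ z • (1 : ℂ →L[ℝ] ℂ)) z :=
  (hasDerivAt_eta hζ hz).complexToReal_fderiv

theorem injOn_eta (hζ : ζ ∈ disk) : InjOn (eta ζ) disk := fun x hx y hy h => by
  rw [← eta_neg_eta hζ hx, h, eta_neg_eta hζ hy]

theorem image_eta_disk (hζ : ζ ∈ disk) : eta ζ '' disk = disk := by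
  ext z
  constructor
  · rintro ⟨y, hy, rfl⟩
    exact eta_mem_disk hζ hy
  · intro hz
    exact ⟨eta (-ζ) z, eta_mem_disk (neg_mem_disk hζ) hz, eta_eta_neg hζ hz⟩

/-- Change of variables on the disk: the Jacobian `|η'|²` is exactly the ratio of the hyperbolic
densities at `z` and at `η z`. -/
theorem lintegral_hyp_comp_eta (hζ : ζ ∈ disk) (f : ℂ → ℝ≥0∞) :
    ∫⁻ z, f (eta ζ z) ∂hyp = ∫⁻ z, f z ∂hyp := by
  rw [lintegral_hyp, lintegral_hyp]
  conv_rhs => rw [← image_eta_disk hζ]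
  rw [lintegral_image_eq_lintegral_abs_det_fderiv_mul _ measurableSet_disk
    (fun z hz => (hasFDerivAt_eta hζ hz).hasFDerivWithinAt) (injOn_eta hζ)]
  refine setLIntegral_congr_fun measurableSet_disk fun z hz => ?_
  have h : hypWeight z = ‖etaDeriv ζ z‖ ^ 2 * hypWeight (eta ζ z) := by
    have h1 := (one_sub_norm_sq_pos hz).ne'
    have h2 := (one_sub_norm_sq_pos (eta_mem_disk hζ hz)).ne'
    rw [hypWeight, hypWeight]
    rw [← norm_etaDeriv_mul hζ hz] at h2 ⊢
    have h3 := left_ne_zero_of_mul h2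
    field_simp
  rw [det_smul_one, h, ENNReal.ofReal_mul (by positivity), abs_of_nonneg (by positivity), mul_assoc]

theorem measurePreserving_eta (hζ : ζ ∈ disk) : MeasurePreserving (eta ζ) hyp hyp := by
  refine ⟨measurable_eta ζ, Measure.ext fun s hs => ?_⟩
  rw [Measure.map_apply (measurable_eta ζ) hs, ← lintegral_indicator_one hs,
    ← lintegral_indicator_one (measurable_eta ζ hs), ← lintegral_hyp_comp_eta hζ (s.indicator 1)]
  rfl

/-- Lebesgue measure on the disk and `hyp` have the same null sets. This lets almost-everywhere
statements be composed with `η`. -/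
theorem quasiMeasurePreserving_eta (hζ : ζ ∈ disk) :
    Measure.QuasiMeasurePreserving (eta ζ) diskMeasure diskMeasure :=
  ((measurePreserving_eta hζ).quasiMeasurePreserving.mono_left absolutelyContinuous_hyp).mono_right
    hyp_absolutelyContinuous

end eta

/-! ### The hyperbolic gradient -/

/-- The length of the gradient of `f` in the hyperbolic metric. -/
def hgrad (f : ℂ → ℝ) (z : ℂ) : ℝ≥0∞ := ENNReal.ofReal (1 - ‖z‖ ^ 2) * ‖fderiv ℝ f z‖ₑ

/-- The Dirichlet energy of `f` on the disk. -/
def energy (f : ℂ → ℝ) : ℝ≥0∞ := ∫⁻ z, hgrad f z ^ 2 ∂hyp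

/-- In dimension two the weights of the squared gradient and of the area cancel; this is the
conformal invariance of the Dirichlet integral. -/
theorem energy_eq (f : ℂ → ℝ) : energy f = ∫⁻ z in (disk : Set ℂ), ‖fderiv ℝ f z‖ₑ ^ 2 := by
  rw [energy, lintegral_hyp]
  refine setLIntegral_congr_fun measurableSet_disk fun z hz => ?_
  have h := one_sub_norm_sq_pos hz
  rw [hgrad, mul_pow, ← mul_assoc, ← ENNReal.ofReal_pow h.le,
    ← ENNReal.ofReal_mul (hypWeight_nonneg z), hypWeight, inv_mul_cancel₀ (by positivity)]
  simp

theorem measurable_hgrad {f : ℂ → ℝ} : Measurable (hgrad f) := by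
  have := measurable_fderiv ℝ f
  unfold hgrad
  fun_prop

theorem hgrad_comp_eta_le {ζ z : ℂ} (hζ : ζ ∈ disk) (hz : z ∈ disk) {f g : ℂ → ℝ}
    (hf : Differentiable ℝ f) (hg : g =ᶠ[𝓝 z] f ∘ eta ζ) : hgrad g z ≤ hgrad f (eta ζ z) := by
  have h1 : HasFDerivAt g ((fderiv ℝ f (eta ζ z)).comp (etaDeriv ζ z • (1 : ℂ →L[ℝ] ℂ))) z :=
    (((hf _).hasFDerivAt).comp z (hasFDerivAt_eta hζ hz)).congr_of_eventuallyEq hg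
  have h2 : ‖fderiv ℝ g z‖ ≤ ‖fderiv ℝ f (eta ζ z)‖ * ‖etaDeriv ζ z‖ := by
    rw [h1.fderiv]
    refine (ContinuousLinearMap.opNorm_comp_le _ _).trans ?_
    gcongr
    refine ContinuousLinearMap.opNorm_le_bound _ (norm_nonneg _) fun x => ?_
    simp
  have h3 := (one_sub_norm_sq_pos hz).le
  rw [hgrad, hgrad, ← norm_etaDeriv_mul hζ hz, ← ofReal_norm, ← ofReal_norm,
    ← ENNReal.ofReal_mul h3, ← ENNReal.ofReal_mul (by positivity)]
  refine ENNReal.ofReal_le_ofReal ?_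
  calc (1 - ‖z‖ ^ 2) * ‖fderiv ℝ g z‖
      ≤ (1 - ‖z‖ ^ 2) * (‖fderiv ℝ f (eta ζ z)‖ * ‖etaDeriv ζ z‖) := by gcongr
    _ = _ := by ring

/-! ### Composition of test functions with Möbius transformations -/

/-- The function `φ ∘ η_ζ` on the disk, extended by zero. -/
def pullbackFun (ζ : ℂ) (φ : ℂ → ℝ) : ℂ → ℝ := indicator disk (φ ∘ eta ζ)

theorem pullbackFun_of_mem {ζ z : ℂ} (hz : z ∈ disk) (φ : ℂ → ℝ) :
    pullbackFun ζ φ z = φ (eta ζ z) := indicator_of_mem hz _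

theorem pullbackFun_eventuallyEq {ζ z : ℂ} (hz : z ∈ disk) (φ : ℂ → ℝ) :
    pullbackFun ζ φ =ᶠ[𝓝 z] φ ∘ eta ζ := by
  filter_upwards [disk.isOpen.mem_nhds hz] with y hy using pullbackFun_of_mem hy φ

theorem isCompact_image_tsupport {ζ : ℂ} (hζ : ζ ∈ disk) (φ : 𝓓(disk, ℝ)) :
    IsCompact (eta (-ζ) '' tsupport φ) :=
  φ.hasCompactSupport.isCompact.image_of_continuousOn fun _ hz =>
    (contDiffAt_eta (neg_mem_disk hζ) (φ.tsupport_subset hz)).continuousAt.continuousWithinAt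

theorem tsupport_pullbackFun_subset {ζ : ℂ} (hζ : ζ ∈ disk) (φ : 𝓓(disk, ℝ)) :
    tsupport (pullbackFun ζ φ) ⊆ eta (-ζ) '' tsupport φ := by
  refine closure_minimal ?_ (isCompact_image_tsupport hζ φ).isClosed
  intro z hz
  have hzd : z ∈ disk := by
    by_contra h
    exact hz (indicator_of_notMem h _)
  rw [Function.mem_support, pullbackFun_of_mem hzd] at hz
  exact ⟨eta ζ z, subset_tsupport _ hz, eta_neg_eta hζ hzd⟩

theorem image_tsupport_subset {ζ : ℂ} (hζ : ζ ∈ disk) (φ : 𝓓(disk, ℝ)) :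
    eta (-ζ) '' tsupport φ ⊆ disk := by
  rintro _ ⟨z, hz, rfl⟩
  exact eta_mem_disk (neg_mem_disk hζ) (φ.tsupport_subset hz)

/-- The test function `φ ∘ η_ζ`. -/
def pullback {ζ : ℂ} (hζ : ζ ∈ disk) (φ : 𝓓(disk, ℝ)) : 𝓓(disk, ℝ) where
  toFun := pullbackFun ζ φ
  contDiff' := by
    rw [contDiff_iff_contDiffAt]
    intro z
    by_cases hz : z ∈ disk
    · exact (φ.contDiff.contDiffAt.comp z (contDiffAt_eta hζ hz)).congr_of_eventuallyEq
        (pullbackFun_eventuallyEq hz φ)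
    -- The support is a compact subset of the open disk, so the extension by zero vanishes near
    -- every outside point, boundary included.
    · have h : z ∉ tsupport (pullbackFun ζ φ) := fun h =>
        hz (image_tsupport_subset hζ φ (tsupport_pullbackFun_subset hζ φ h))
      exact contDiffAt_const.congr_of_eventuallyEq (notMem_tsupport_iff_eventuallyEq.1 h)
  hasCompactSupport' := (isCompact_image_tsupport hζ φ).of_isClosed_subset (isClosed_tsupport _)
    (tsupport_pullbackFun_subset hζ φ)
  tsupport_subset' := (tsupport_pullbackFun_subset hζ φ).trans (image_tsupport_subset hζ φ)

theorem coe_pullback {ζ : ℂ} (hζ : ζ ∈ disk) (φ : 𝓓(disk, ℝ)) :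
    (pullback hζ φ : ℂ → ℝ) = pullbackFun ζ φ := rfl

theorem pullback_apply {ζ z : ℂ} (hζ : ζ ∈ disk) (hz : z ∈ disk) (φ : 𝓓(disk, ℝ)) :
    pullback hζ φ z = φ (eta ζ z) := pullbackFun_of_mem hz φ

theorem pullback_sub {ζ : ℂ} (hζ : ζ ∈ disk) (φ ψ : 𝓓(disk, ℝ)) :
    pullback hζ (φ - ψ) = pullback hζ φ - pullback hζ ψ := by
  ext z
  by_cases hz : z ∈ disk
  · simp [pullback_apply hζ hz]
  · simp [coe_pullback, pullbackFun, indicator_of_notMem (s := (disk : Set ℂ)) hz]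

theorem hgrad_pullback_le {ζ z : ℂ} (hζ : ζ ∈ disk) (hz : z ∈ disk) (φ : 𝓓(disk, ℝ)) :
    hgrad (pullback hζ φ) z ≤ hgrad φ (eta ζ z) :=
  hgrad_comp_eta_le hζ hz (testFunction_differentiable φ) (pullbackFun_eventuallyEq hz φ)

theorem energy_pullback_le {ζ : ℂ} (hζ : ζ ∈ disk) (φ : 𝓓(disk, ℝ)) :
    energy (pullback hζ φ) ≤ energy φ := by
  rw [energy, energy, ← lintegral_hyp_comp_eta hζ fun z => hgrad φ z ^ 2]
  refine lintegral_mono_ae ?_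
  filter_upwards [ae_hyp_mem_disk] with z hz
  gcongr
  exact hgrad_pullback_le hζ hz φ

/-! ### Hardy and Sobolev inequalities in the hyperbolic disk -/

theorem sq_lintegral_mul_le {α : Type*} [MeasurableSpace α] {μ : Measure α} {f g : α → ℝ≥0∞}
    (hf : AEMeasurable f μ) (hg : AEMeasurable g μ) :
    (∫⁻ x, f x * g x ∂μ) ^ 2 ≤ (∫⁻ x, f x ^ 2 ∂μ) * ∫⁻ x, g x ^ 2 ∂μ := by
  have h := ENNReal.lintegral_mul_le_Lp_mul_Lq μ Real.HolderConjugate.two_two hf hg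
  simp only [Pi.mul_apply, ENNReal.rpow_ofNat] at h
  calc (∫⁻ x, f x * g x ∂μ) ^ 2
      ≤ ((∫⁻ x, f x ^ 2 ∂μ) ^ (1 / 2 : ℝ) * (∫⁻ x, g x ^ 2 ∂μ) ^ (1 / 2 : ℝ)) ^ 2 := by gcongr
    _ = _ := by
      rw [mul_pow, ← ENNReal.rpow_ofNat, ← ENNReal.rpow_ofNat, ← ENNReal.rpow_mul,
        ← ENNReal.rpow_mul]
      norm_num

/-- Allows weights that blow up on the unit circle: `f` vanishes near every point where `h` may be
singular. -/
theorem contDiff_mul_of_tsupport_subset {f h : ℂ → ℝ} {s : Set ℂ} (hf : ContDiff ℝ 1 f)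
    (hs : tsupport f ⊆ s) (hh : ∀ z ∈ s, ContDiffAt ℝ 1 h z) :
    ContDiff ℝ 1 fun z => f z * h z := by
  rw [contDiff_iff_contDiffAt]
  intro z
  by_cases hz : z ∈ tsupport f
  · exact hf.contDiffAt.mul (hh z (hs hz))
  · refine contDiffAt_const (c := (0 : ℝ)).congr_of_eventuallyEq ?_
    filter_upwards [notMem_tsupport_iff_eventuallyEq.1 hz] with y hy
    simp [hy]

/-- Divergence theorem for the field `z ↦ g(z) z`, whose divergence is `z · ∇g + 2g` in the plane;
each coordinate is integrated by parts. -/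
theorem integral_fderiv_apply_self {g : ℂ → ℝ} (hg : ContDiff ℝ 1 g) (hc : HasCompactSupport g) :
    Integrable (fun z => fderiv ℝ g z z) ∧ ∫ z, fderiv ℝ g z z = -(2 * ∫ z, g z) := by
  have hgi : Integrable g := hg.continuous.integrable_of_hasCompactSupport hc
  have hd : ∀ v : ℂ, ∀ L : ℂ →L[ℝ] ℝ, Integrable (fun z => L z * fderiv ℝ g z v) ∧
      ∫ z, L z * fderiv ℝ g z v = -(L v * ∫ z, g z) := by
    intro v L
    have h1 : Continuous fun z => fderiv ℝ g z v :=
      (hg.continuous_fderiv one_ne_zero).clm_apply continuous_const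
    have h2 : HasCompactSupport fun z => fderiv ℝ g z v := hc.fderiv_apply ℝ v
    have h3 : Integrable (fun z => L z * fderiv ℝ g z v) :=
      (L.continuous.mul h1).integrable_of_hasCompactSupport h2.mul_left
    refine ⟨h3, ?_⟩
    rw [integral_mul_fderiv_eq_neg_fderiv_mul_of_integrable _ h3 _
      (fun z _ => L.differentiableAt) (fun z _ => hg.differentiable one_ne_zero z)]
    · simp [integral_const_mul]
    · simpa using hgi.const_mul (L v)
    · exact (L.continuous.mul hg.continuous).integrable_of_hasCompactSupport hc.mul_left
  have he : (fun z => fderiv ℝ g z z) = fun z =>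
      Complex.reCLM z * fderiv ℝ g z 1 + Complex.imCLM z * fderiv ℝ g z Complex.I := by
    ext z
    conv_lhs => enter [2]; rw [← Complex.re_add_im z]
    have h1 : (z.re : ℂ) = z.re • (1 : ℂ) := by simp
    have h2 : (z.im : ℂ) * Complex.I = z.im • Complex.I := by simp
    rw [h1, h2, map_add, map_smul, map_smul]
    simp
  obtain ⟨h1, h1'⟩ := hd 1 Complex.reCLM
  obtain ⟨h2, h2'⟩ := hd Complex.I Complex.imCLM
  rw [he]
  refine ⟨h1.add h2, ?_⟩
  rw [integral_add h1 h2, h1', h2']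
  simp
  ring

theorem lintegral_hgrad (f : ℂ → ℝ) : ∫⁻ z, hgrad f z ∂hyp =
    ∫⁻ z in (disk : Set ℂ), ‖(1 - ‖z‖ ^ 2)⁻¹‖ₑ * ‖fderiv ℝ f z‖ₑ := by
  rw [lintegral_hyp]
  refine setLIntegral_congr_fun measurableSet_disk fun z hz => ?_
  have h := one_sub_norm_sq_pos hz
  rw [hgrad, ← mul_assoc, ← ENNReal.ofReal_mul (hypWeight_nonneg z), hypWeight,
    Real.enorm_of_nonneg (by positivity)]
  congr 2
  field_simp

theorem hasFDerivAt_inv_one_sub_norm_sq {z : ℂ} (hz : z ∈ disk) :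
    HasFDerivAt (fun z : ℂ => (1 - ‖z‖ ^ 2)⁻¹) ((2 * hypWeight z) • innerSL ℝ z) z := by
  have h := ((hasStrictFDerivAt_norm_sq z).hasFDerivAt.const_sub 1)
  have h1 := (hasDerivAt_inv (one_sub_norm_sq_pos hz).ne').comp_hasFDerivAt z h
  refine h1.congr_fderiv ?_
  ext y
  simp [hypWeight]
  ring

theorem contDiffAt_inv_one_sub_norm_sq {z : ℂ} (hz : z ∈ disk) :
    ContDiffAt ℝ 1 (fun z : ℂ => (1 - ‖z‖ ^ 2)⁻¹) z := by
  have h : ContDiffAt ℝ 1 (fun z : ℂ => 1 - ‖z‖ ^ 2) z :=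
    contDiffAt_const.sub (contDiff_norm_sq ℝ).contDiffAt
  exact h.inv (one_sub_norm_sq_pos hz).ne'

/-- The function `f` divided by `1 - |z|²`. -/
def conformalQuotient (f : ℂ → ℝ) (z : ℂ) : ℝ := f z * (1 - ‖z‖ ^ 2)⁻¹

theorem contDiff_conformalQuotient {f : ℂ → ℝ} (hf : ContDiff ℝ 1 f) (hs : tsupport f ⊆ disk) :
    ContDiff ℝ 1 (conformalQuotient f) :=
  contDiff_mul_of_tsupport_subset hf hs fun _ hz => contDiffAt_inv_one_sub_norm_sq hz

theorem fderiv_conformalQuotient {f : ℂ → ℝ} (hf : ContDiff ℝ 1 f) {z : ℂ} (hz : z ∈ disk) :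
    fderiv ℝ (conformalQuotient f) z =
      f z • ((2 * hypWeight z) • innerSL ℝ z) + (1 - ‖z‖ ^ 2)⁻¹ • fderiv ℝ f z :=
  ((hf.differentiable one_ne_zero z).hasFDerivAt.mul (hasFDerivAt_inv_one_sub_norm_sq hz)).fderiv

theorem tsupport_conformalQuotient_subset (f : ℂ → ℝ) :
    tsupport (conformalQuotient f) ⊆ tsupport f := tsupport_mul_subset_left

theorem fderiv_conformalQuotient_of_notMem {f : ℂ → ℝ} (hs : tsupport f ⊆ disk) {z : ℂ}
    (hz : z ∉ disk) : fderiv ℝ (conformalQuotient f) z = 0 :=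
  fderiv_of_notMem_tsupport (𝕜 := ℝ)
    fun h => hz (hs (tsupport_conformalQuotient_subset f h))

theorem lintegral_eq_setLIntegral_of_eq_zero {α : Type*} [MeasurableSpace α] {μ : Measure α}
    {s : Set α} (hs : MeasurableSet s) {f : α → ℝ≥0∞} (hf : ∀ x ∉ s, f x = 0) :
    ∫⁻ x, f x ∂μ = ∫⁻ x in s, f x ∂μ := by
  rw [← lintegral_indicator hs]
  congr 1
  ext x
  by_cases hx : x ∈ s
  · simp [hx]
  · simp [hx, hf x hx]

theorem integrable_mul_hypWeight {f : ℂ → ℝ} (hf : ContDiff ℝ 1 f) (hc : HasCompactSupport f)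
    (hs : tsupport f ⊆ disk) : Integrable fun z => f z * hypWeight z := by
  have hw : ContDiff ℝ 1 fun z => f z * hypWeight z :=
    contDiff_mul_of_tsupport_subset hf hs fun z hz =>
      ((contDiffAt_inv_one_sub_norm_sq hz).pow 2).congr_of_eventuallyEq
        (Eventually.of_forall fun _ => (inv_pow _ _).symm)
  exact hw.continuous.integrable_of_hasCompactSupport hc.mul_right

theorem integrable_hyp_of_contDiff {f : ℂ → ℝ} (hf : ContDiff ℝ 1 f) (hc : HasCompactSupport f)
    (hs : tsupport f ⊆ disk) : Integrable f hyp := by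
  simpa [integrable_hyp_iff, mul_comm] using (integrable_mul_hypWeight hf hc hs).integrableOn

/-- The `L¹` Hardy inequality. -/
theorem two_mul_lintegral_le_lintegral_hgrad {f : ℂ → ℝ} (hf : ContDiff ℝ 1 f)
    (hc : HasCompactSupport f) (hs : tsupport f ⊆ disk) (h0 : ∀ z, 0 ≤ f z) :
    2 * ∫⁻ z, ‖f z‖ₑ ∂hyp ≤ ∫⁻ z, hgrad f z ∂hyp := by
  set g := conformalQuotient f with hg
  have hgs : ContDiff ℝ 1 g := contDiff_conformalQuotient hf hs
  have hgc : HasCompactSupport g := hc.mul_right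
  have hfz : ∀ z ∉ disk, f z = 0 := fun z hz =>
    image_eq_zero_of_notMem_tsupport fun h => hz (hs h)
  obtain ⟨hi, he⟩ := integral_fderiv_apply_self hgs hgc
  have hgi : Integrable g := hgs.continuous.integrable_of_hasCompactSupport hgc
  have hwi := integrable_mul_hypWeight hf hc hs
  -- Differentiating the weight gives `2|z|² f w` with `w` the hyperbolic density, and `2g = 2(1 -
  -- |z|²) f w`; the sum is exactly `2 f w`.
  have hpt : ∀ z ∈ disk, fderiv ℝ g z z + 2 * g z =
      2 * (f z * hypWeight z) + (1 - ‖z‖ ^ 2)⁻¹ * fderiv ℝ f z z := by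
    intro z hz
    have h := (one_sub_norm_sq_pos hz).ne'
    rw [fderiv_conformalQuotient hf hz]
    simp only [add_apply, smul_apply, innerSL_apply_apply,
      real_inner_self_eq_norm_sq, smul_eq_mul, hg, conformalQuotient, hypWeight]
    field_simp
    ring
  -- The subtracted divergence integrates to zero. By the previous identity the integrand is `-(1 -
  -- |z|²)⁻¹ z · ∇f`, which is bounded by the hyperbolic gradient because `|z| < 1`.
  have hkey : ∫ z, (2 * (f z * hypWeight z) - (fderiv ℝ g z z + 2 * g z)) =
      2 * ∫ z, f z * hypWeight z := by
    have hi2 : Integrable fun z => fderiv ℝ g z z + 2 * g z := hi.add (hgi.const_mul 2)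
    rw [integral_sub (hwi.const_mul 2) hi2, integral_add hi (hgi.const_mul 2), he,
      integral_const_mul, integral_const_mul]
    ring
  have hl : 2 * ∫⁻ z, ‖f z‖ₑ ∂hyp = ‖2 * ∫ z, f z * hypWeight z‖ₑ := by
    have h1 : ∀ z, 0 ≤ f z * hypWeight z := fun z => mul_nonneg (h0 z) (hypWeight_nonneg z)
    rw [Real.enorm_of_nonneg (mul_nonneg zero_le_two (integral_nonneg h1)),
      ENNReal.ofReal_mul zero_le_two, ofReal_integral_eq_lintegral_ofReal hwi
      (Eventually.of_forall h1), lintegral_hyp]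
    rw [lintegral_eq_setLIntegral_of_eq_zero measurableSet_disk
      (f := fun z => ENNReal.ofReal (f z * hypWeight z)) fun z hz => by simp [hfz z hz]]
    congr 1
    · simp
    · refine lintegral_congr fun z => ?_
      rw [ENNReal.ofReal_mul (h0 z), Real.enorm_of_nonneg (h0 z), mul_comm]
  rw [hl, ← hkey, lintegral_hgrad]
  refine (enorm_integral_le_lintegral_enorm _).trans ?_
  rw [lintegral_eq_setLIntegral_of_eq_zero measurableSet_disk fun z hz => by
    simp [hfz z hz, hg, fderiv_conformalQuotient_of_notMem hs hz, conformalQuotient]]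
  refine setLIntegral_mono' measurableSet_disk fun z hz => ?_
  rw [hpt z hz, sub_add_cancel_left, enorm_neg, enorm_mul]
  gcongr
  rw [← ofReal_norm, ← ofReal_norm]
  refine ENNReal.ofReal_le_ofReal (((fderiv ℝ f z).le_opNorm z).trans ?_)
  exact mul_le_of_le_one_right (norm_nonneg _) (mem_disk.1 hz).le

/-- The `L¹` Sobolev inequality. -/
theorem exists_lintegral_sq_le : ∃ C : ℝ≥0∞, C ≠ ⊤ ∧ ∀ f : ℂ → ℝ, ContDiff ℝ 1 f →
    HasCompactSupport f → tsupport f ⊆ disk → (∀ z, 0 ≤ f z) →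
    ∫⁻ z, ‖f z‖ₑ ^ 2 ∂hyp ≤ C * (∫⁻ z, hgrad f z ∂hyp) ^ 2 := by
  have hp : Real.HolderConjugate (Module.finrank ℝ ℂ) 2 := by
    rw [Complex.finrank_real_complex]
    exact_mod_cast Real.HolderConjugate.two_two
  set C := lintegralPowLePowLIntegralFDerivConst (volume : Measure ℂ) 2
  refine ⟨C * 2 ^ 2, by finiteness, fun f hf hc hs h0 => ?_⟩
  -- The Euclidean Sobolev inequality is applied to `g = f / (1 - |z|²)`, for which `g² dz = f²
  -- dhyp`. The term of `∇g` coming from the weight costs at most `2 ∫ f dhyp`, which the Hardy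
  -- inequality absorbs.
  have hgs := contDiff_conformalQuotient hf hs
  have hgc : HasCompactSupport (conformalQuotient f) := hc.mul_right
  have h1 := lintegral_pow_le_pow_lintegral_fderiv volume hgs hgc hp
  simp only [ENNReal.rpow_ofNat] at h1
  have h2 : ∫⁻ z, ‖f z‖ₑ ^ 2 ∂hyp ≤ ∫⁻ z, ‖conformalQuotient f z‖ₑ ^ 2 := by
    rw [lintegral_hyp]
    refine le_trans (le_of_eq ?_) (setLIntegral_le_lintegral (disk : Set ℂ) _)
    refine setLIntegral_congr_fun measurableSet_disk fun z _ => ?_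
    rw [conformalQuotient, enorm_mul, mul_pow, mul_comm, hypWeight, ← inv_pow, ← enorm_pow,
      ← enorm_pow, Real.enorm_of_nonneg (sq_nonneg ((1 - ‖z‖ ^ 2)⁻¹))]
  have h3 : ∫⁻ z, ‖fderiv ℝ (conformalQuotient f) z‖ₑ ≤ 2 * ∫⁻ z, hgrad f z ∂hyp := by
    calc ∫⁻ z, ‖fderiv ℝ (conformalQuotient f) z‖ₑ
        = ∫⁻ z in (disk : Set ℂ), ‖fderiv ℝ (conformalQuotient f) z‖ₑ :=
          lintegral_eq_setLIntegral_of_eq_zero measurableSet_disk fun z hz => by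
            rw [fderiv_conformalQuotient_of_notMem hs hz, ← ofReal_norm, norm_zero,
              ENNReal.ofReal_zero]
      _ ≤ ∫⁻ z in (disk : Set ℂ), (2 * (ENNReal.ofReal (hypWeight z) * ‖f z‖ₑ) +
            ‖(1 - ‖z‖ ^ 2)⁻¹‖ₑ * ‖fderiv ℝ f z‖ₑ) := by
          refine setLIntegral_mono' measurableSet_disk fun z hz => ?_
          rw [fderiv_conformalQuotient hf hz]
          have hw := hypWeight_nonneg z
          have hr := (one_sub_norm_sq_pos hz).le
          have hn : ‖f z • ((2 * hypWeight z) • innerSL ℝ z) + (1 - ‖z‖ ^ 2)⁻¹ • fderiv ℝ f z‖ ≤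
              2 * (hypWeight z * ‖f z‖) + (1 - ‖z‖ ^ 2)⁻¹ * ‖fderiv ℝ f z‖ := by
            refine (norm_add_le _ _).trans ?_
            rw [norm_smul, norm_smul, norm_smul, innerSL_apply_norm,
              Real.norm_of_nonneg (inv_nonneg.2 hr),
              Real.norm_of_nonneg (mul_nonneg zero_le_two hw)]
            have h4 := mul_le_mul_of_nonneg_left (mem_disk.1 hz).le
              (show 0 ≤ 2 * (hypWeight z * ‖f z‖) by positivity)
            linarith
          rw [Real.enorm_of_nonneg (inv_nonneg.2 hr), ← ofReal_norm, ← ofReal_norm, ← ofReal_norm,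
            ← ENNReal.ofReal_mul hw, ← ENNReal.ofReal_mul (inv_nonneg.2 hr),
            ← ENNReal.ofReal_ofNat 2, ← ENNReal.ofReal_mul zero_le_two,
            ← ENNReal.ofReal_add (by positivity) (by positivity)]
          exact ENNReal.ofReal_le_ofReal hn
      _ = 2 * ∫⁻ z, ‖f z‖ₑ ∂hyp + ∫⁻ z, hgrad f z ∂hyp := by
          have hm := measurable_hypWeight
          have hm' := hf.continuous.measurable
          rw [lintegral_add_left (by fun_prop), lintegral_const_mul _ (by fun_prop),
            lintegral_hyp, lintegral_hgrad]
      _ ≤ 2 * ∫⁻ z, hgrad f z ∂hyp := by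
          rw [two_mul (∫⁻ z, hgrad f z ∂hyp)]
          gcongr
          exact two_mul_lintegral_le_lintegral_hgrad hf hc hs h0
  calc _ ≤ _ := h2
    _ ≤ _ := h1
    _ ≤ C * (2 * ∫⁻ z, hgrad f z ∂hyp) ^ 2 := by gcongr
    _ = _ := by rw [mul_pow, mul_assoc]

/-- The `L²` Hardy inequality. -/
theorem lintegral_sq_le_energy (φ : 𝓓(disk, ℝ)) : ∫⁻ z, ‖φ z‖ₑ ^ 2 ∂hyp ≤ energy φ := by
  have hφ : ContDiff ℝ 1 φ := φ.contDiff.of_le (by simp)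
  have hφ2 : ContDiff ℝ 1 fun z => φ z ^ 2 := hφ.pow 2
  have heq : (fun z => φ z ^ 2) = fun z => φ z * φ z := funext fun z => sq _
  have hc : HasCompactSupport fun z => φ z ^ 2 := by
    rw [heq]
    exact φ.hasCompactSupport.mul_right
  have hs : tsupport (fun z => φ z ^ 2) ⊆ disk := by
    rw [heq]
    exact tsupport_mul_subset_left.trans φ.tsupport_subset
  -- The `L¹` inequality for `φ²` and Cauchy–Schwarz give `Q² ≤ Q E` for `Q = ∫ φ² dhyp`. Cancelling
  -- `Q` requires it to be finite, which compact support provides.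
  have h1 := two_mul_lintegral_le_lintegral_hgrad hφ2 hc hs fun z => sq_nonneg _
  have h2 : ∀ z, hgrad (fun z => φ z ^ 2) z = 2 * (‖φ z‖ₑ * hgrad φ z) := by
    intro z
    have h : fderiv ℝ (fun z => φ z ^ 2) z = (2 * φ z) • fderiv ℝ φ z := by
      simpa using (((hφ.differentiable one_ne_zero z).hasFDerivAt).pow 2).fderiv
    rw [hgrad, hgrad, h, ← ofReal_norm, norm_smul, norm_mul, ENNReal.ofReal_mul (by positivity),
      ENNReal.ofReal_mul (by positivity), ofReal_norm, ofReal_norm, ofReal_norm]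
    rw [show ‖(2 : ℝ)‖ₑ = 2 by simp [Real.enorm_of_nonneg]]
    ring
  simp only [h2, enorm_pow] at h1
  have hm : Measurable fun z => ‖φ z‖ₑ := φ.continuous.measurable.enorm
  have hm2 : Measurable (hgrad φ) := measurable_hgrad
  rw [lintegral_const_mul _ (by fun_prop),
    ENNReal.mul_le_mul_iff_right two_ne_zero (by finiteness)] at h1
  set Q := ∫⁻ z, ‖φ z‖ₑ ^ 2 ∂hyp with hQ
  have hfin : Q ≠ ⊤ := by
    have := (integrable_hyp_of_contDiff hφ2 hc hs).hasFiniteIntegral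
    simpa only [HasFiniteIntegral, enorm_pow, lt_top_iff_ne_top] using this
  rcases eq_or_ne Q 0 with h0 | h0
  · simp [h0]
  have h3 : Q * Q ≤ Q * energy φ := by
    rw [← sq]
    calc Q ^ 2 ≤ (∫⁻ z, ‖φ z‖ₑ * hgrad φ z ∂hyp) ^ 2 := by gcongr
      _ ≤ _ := sq_lintegral_mul_le hm.aemeasurable measurable_hgrad.aemeasurable
  exact (ENNReal.mul_le_mul_iff_right h0 hfin).1 h3

/-! ### Decay of level sets and small-energy exponential integrability -/

/-- The derivative vanishes wherever the step attains its minimum or maximum. The half-open interval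
makes consecutive level slabs disjoint. -/
theorem exists_smooth_step : ∃ (τ : ℝ → ℝ) (M : ℝ), 0 ≤ M ∧ ContDiff ℝ 1 τ ∧ (∀ s, 0 ≤ τ s) ∧
    (∀ s ≤ 0, τ s = 0) ∧ (∀ s, 1 ≤ s → τ s = 1) ∧ (∀ s, |deriv τ s| ≤ M) ∧
    ∀ s ∉ Ico (0 : ℝ) 1, deriv τ s = 0 := by
  have hc : ContDiff ℝ 1 Real.smoothTransition := Real.smoothTransition.contDiff
  have h0 : ∀ s ∉ Ico (0 : ℝ) 1, deriv Real.smoothTransition s = 0 := by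
    intro s hs
    rcases lt_or_ge s 0 with h | h
    · refine IsLocalMin.deriv_eq_zero (Eventually.of_forall fun x => ?_)
      rw [Real.smoothTransition.zero_of_nonpos h.le]
      exact Real.smoothTransition.nonneg x
    · have h1 : 1 ≤ s := by
        by_contra h2
        exact hs ⟨h, not_le.1 h2⟩
      refine IsLocalMax.deriv_eq_zero (Eventually.of_forall fun x => ?_)
      rw [Real.smoothTransition.one_of_one_le h1]
      exact Real.smoothTransition.le_one x
  obtain ⟨M, hM⟩ := (isCompact_Icc (a := (0 : ℝ)) (b := 1)).exists_bound_of_continuousOn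
    (hc.continuous_deriv le_rfl).continuousOn
  refine ⟨Real.smoothTransition, max M 0, le_max_right _ _, hc, Real.smoothTransition.nonneg,
    fun s => Real.smoothTransition.zero_of_nonpos, fun s => Real.smoothTransition.one_of_one_le,
    fun s => ?_, h0⟩
  by_cases hs : s ∈ Ico (0 : ℝ) 1
  · exact (hM s (Ico_subset_Icc_self hs)).trans (le_max_left _ _)
  · simp [h0 s hs]

/-- The Sobolev inequality is applied to `τ ((φ - t) / h)`, which equals one on the upper level set
and whose gradient lives on the slab `t ≤ φ < t + h`. Cauchy–Schwarz on the slab separates its area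
from its energy. The condition `0 ≤ t` keeps the support of the truncation inside that of `φ`. -/
theorem exists_level_set_step : ∃ K : ℝ≥0∞, K ≠ ⊤ ∧ ∀ (φ : 𝓓(disk, ℝ)) (t h : ℝ), 0 ≤ t → 0 < h →
    hyp {z | t + h ≤ φ z} ≤ K * ENNReal.ofReal (h⁻¹ ^ 2) * hyp {z | t ≤ φ z} *
      ∫⁻ z in φ ⁻¹' Ico t (t + h), hgrad φ z ^ 2 ∂hyp := by
  obtain ⟨C, hC, hsob⟩ := exists_lintegral_sq_le
  obtain ⟨τ, M, hM, hτ, hτ0, hτz, hτ1, hτM, hτd⟩ := exists_smooth_step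
  refine ⟨C * ENNReal.ofReal (M ^ 2), by finiteness, fun φ t h ht hh => ?_⟩
  have hφ : ContDiff ℝ 1 φ := φ.contDiff.of_le (by simp)
  set f : ℂ → ℝ := fun z => τ (h⁻¹ * (φ z - t)) with hf
  set S := φ ⁻¹' Ico t (t + h)
  have hS : MeasurableSet S := φ.continuous.measurable measurableSet_Ico
  have hfc : ContDiff ℝ 1 f := hτ.comp (contDiff_const.mul (hφ.sub contDiff_const))
  have hsupp : Function.support f ⊆ Function.support φ := by
    intro z hz hφz
    refine hz (hτz _ ?_)
    rw [hφz]
    have : 0 ≤ h⁻¹ * t := by positivity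
    linarith
  have hts : tsupport f ⊆ tsupport φ := closure_mono hsupp
  have hcs : HasCompactSupport f := φ.hasCompactSupport.mono hsupp
  have hgrad_le : ∀ z, hgrad f z ≤
      ENNReal.ofReal (M * h⁻¹) * (S.indicator 1 z * hgrad φ z) := by
    intro z
    have hd : HasFDerivAt f (deriv τ (h⁻¹ * (φ z - t)) • (h⁻¹ • fderiv ℝ φ z)) z :=
      (hτ.differentiable one_ne_zero _).hasDerivAt.comp_hasFDerivAt z
        (((hφ.differentiable one_ne_zero z).hasFDerivAt.sub_const t).const_mul h⁻¹)
    by_cases hz : z ∈ S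
    · rw [indicator_of_mem hz, Pi.one_apply, one_mul, hgrad, hgrad, hd.fderiv, ← ofReal_norm,
        ← ofReal_norm, norm_smul, norm_smul, Real.norm_of_nonneg (inv_nonneg.2 hh.le), ← mul_assoc,
        ENNReal.ofReal_mul (by positivity), mul_left_comm]
      exact mul_le_mul_left (ENNReal.ofReal_le_ofReal
        (mul_le_mul_of_nonneg_right (hτM _) (inv_nonneg.2 hh.le))) _
    · have h0 : deriv τ (h⁻¹ * (φ z - t)) = 0 := by
        refine hτd _ fun h1 => hz ⟨?_, ?_⟩
        · have := h1.1
          rw [mul_nonneg_iff_of_pos_left (inv_pos.2 hh)] at this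
          linarith
        · have := h1.2
          rw [inv_mul_lt_iff₀ hh] at this
          linarith
      rw [hgrad, hd.fderiv, h0, zero_smul, ← ofReal_norm, norm_zero, ENNReal.ofReal_zero, mul_zero]
      exact zero_le
  have hlow : hyp {z | t + h ≤ φ z} ≤ ∫⁻ z, ‖f z‖ₑ ^ 2 ∂hyp := by
    have hm : MeasurableSet {z | t + h ≤ φ z} :=
      measurableSet_le measurable_const φ.continuous.measurable
    rw [← lintegral_indicator_one hm]
    refine lintegral_mono fun z => ?_
    by_cases hz : z ∈ {z | t + h ≤ φ z}
    · have h1 : f z = 1 := by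
        refine hτ1 _ ?_
        rw [le_inv_mul_iff₀ hh]
        linarith [show t + h ≤ φ z from hz]
      simp [hz, h1]
    · simp [hz]
  have hgm : Measurable (hgrad φ) := measurable_hgrad
  have hint : (∫⁻ z, hgrad f z ∂hyp) ^ 2 ≤ ENNReal.ofReal (M * h⁻¹) ^ 2 *
      (hyp {z | t ≤ φ z} * ∫⁻ z in S, hgrad φ z ^ 2 ∂hyp) := by
    have him : Measurable (S.indicator (1 : ℂ → ℝ≥0∞)) := measurable_one.indicator hS
    calc (∫⁻ z, hgrad f z ∂hyp) ^ 2
        ≤ (∫⁻ z, ENNReal.ofReal (M * h⁻¹) * (S.indicator 1 z * hgrad φ z) ∂hyp) ^ 2 := by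
          gcongr
          exact hgrad_le _
      _ = ENNReal.ofReal (M * h⁻¹) ^ 2 *
            (∫⁻ z, S.indicator 1 z * (S.indicator 1 z * hgrad φ z) ∂hyp) ^ 2 := by
          rw [lintegral_const_mul _ (by fun_prop), mul_pow]
          congr 3
          ext z
          by_cases hz : z ∈ S <;> simp [hz]
      _ ≤ ENNReal.ofReal (M * h⁻¹) ^ 2 * ((∫⁻ z, S.indicator 1 z ^ 2 ∂hyp) *
            ∫⁻ z, (S.indicator 1 z * hgrad φ z) ^ 2 ∂hyp) := by
          gcongr
          exact sq_lintegral_mul_le him.aemeasurable (by fun_prop)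
      _ ≤ _ := by
          refine mul_le_mul_right (mul_le_mul' ?_ ?_) _
          · rw [← lintegral_indicator_one
              (measurableSet_le measurable_const φ.continuous.measurable)]
            refine lintegral_mono fun z => ?_
            by_cases hz : z ∈ S
            · have : z ∈ {z | t ≤ φ z} := hz.1
              simp [hz, this]
            · simp [hz]
          · rw [← lintegral_indicator hS]
            refine lintegral_mono fun z => ?_
            by_cases hz : z ∈ S <;> simp [hz]
  refine hlow.trans ((hsob f hfc hcs (hts.trans φ.tsupport_subset) fun z => hτ0 _).trans ?_)
  refine (mul_le_mul_right hint C).trans (le_of_eq ?_)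
  rw [← ENNReal.ofReal_pow (by positivity), mul_pow, ENNReal.ofReal_mul (by positivity)]
  ring

/-- The arithmetic–geometric mean inequality in extended nonnegative reals. -/
theorem prod_le_pow_of_sum_le {x : ℕ → ℝ≥0∞} {N : ℕ} {q : ℝ≥0∞} (hq : q ≠ ⊤)
    (h : ∑ j ∈ Finset.range N, x j ≤ N * q) : ∏ j ∈ Finset.range N, x j ≤ q ^ N := by
  rcases Nat.eq_zero_or_pos N with rfl | hN
  · simp
  have hfin : ∀ j ∈ Finset.range N, x j ≠ ⊤ := fun j hj =>
    ((ENNReal.sum_lt_top.1 (h.trans_lt (by finiteness))) j hj).ne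
  have hx : ∀ j ∈ Finset.range N, x j = ((x j).toNNReal : ℝ≥0∞) := fun j hj =>
    (ENNReal.coe_toNNReal (hfin j hj)).symm
  lift q to NNReal using hq
  rw [Finset.sum_congr rfl hx] at h
  rw [Finset.prod_congr rfl hx]
  norm_cast at h ⊢
  have hN' : (N : NNReal) ≠ 0 := by exact_mod_cast hN.ne'
  have h1 := NNReal.geom_mean_le_arith_mean_weighted (Finset.range N) (fun _ => (N : NNReal)⁻¹)
    (fun j => (x j).toNNReal) (by simp [hN'])
  rw [NNReal.finsetProd_rpow, ← Finset.mul_sum] at h1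
  have h2 : (∏ j ∈ Finset.range N, (x j).toNNReal) ^ ((N : ℝ)⁻¹) ≤ q := by
    refine le_trans (by simpa using h1) ?_
    rw [inv_mul_le_iff₀ (by positivity)]
    exact_mod_cast h
  calc _ = ((∏ j ∈ Finset.range N, (x j).toNNReal) ^ ((N : ℝ)⁻¹)) ^ N :=
        (NNReal.rpow_inv_natCast_pow _ hN.ne').symm
    _ ≤ q ^ N := by gcongr

/-- Level one is handled by Chebyshev and the `L²` Hardy inequality. From there `n²` steps of height
`1/n` reach level `n + 1`, each contributing a factor `K n² e_j`. The slab energies `e_j` sum to at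
most the total energy, so their mean is at most `energy φ / n²` and the factors `n²` cancel in the
geometric mean. -/
theorem exists_measure_level_set_le : ∃ K : ℝ≥0∞, K ≠ ⊤ ∧ ∀ (φ : 𝓓(disk, ℝ)), energy φ ≠ ⊤ →
    ∀ n : ℕ, hyp {z | (n : ℝ) + 1 ≤ φ z} ≤ energy φ * (K * energy φ) ^ (n ^ 2) := by
  obtain ⟨K, hK, hstep⟩ := exists_level_set_step
  refine ⟨K, hK, fun φ hE n => ?_⟩
  have hbase : hyp {z | (1 : ℝ) ≤ φ z} ≤ energy φ := by
    refine le_trans ?_ (lintegral_sq_le_energy φ)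
    rw [← lintegral_indicator_one (measurableSet_le measurable_const φ.continuous.measurable)]
    refine lintegral_mono fun z => ?_
    by_cases hz : z ∈ {z | (1 : ℝ) ≤ φ z}
    · have h1 : 1 ≤ ‖φ z‖ₑ := by
        rw [← ofReal_norm, ← ENNReal.ofReal_one]
        exact ENNReal.ofReal_le_ofReal (hz.trans (le_abs_self _))
      simpa [hz] using one_le_pow₀ h1
    · simp [hz]
  rcases Nat.eq_zero_or_pos n with rfl | hn
  · simpa using hbase
  set t : ℕ → ℝ := fun j => 1 + j * (n : ℝ)⁻¹ with ht
  have hn' : (0 : ℝ) < n := by exact_mod_cast hn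
  have htsucc : ∀ j, t j + (n : ℝ)⁻¹ = t (j + 1) := fun j => by
    simp only [ht]
    push_cast
    ring
  set e : ℕ → ℝ≥0∞ := fun j => ∫⁻ z in φ ⁻¹' Ico (t j) (t (j + 1)), hgrad φ z ^ 2 ∂hyp with he
  have hiter : ∀ N, hyp {z | t N ≤ φ z} ≤
      energy φ * ∏ j ∈ Finset.range N, (K * ENNReal.ofReal ((n : ℝ) ^ 2) * e j) := by
    intro N
    induction N with
    | zero => simpa [ht] using hbase
    | succ N ih =>
      have h1 := hstep φ (t N) (n : ℝ)⁻¹ (by positivity) (by positivity)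
      rw [htsucc, inv_inv] at h1
      rw [Finset.prod_range_succ]
      calc _ ≤ _ := h1
        _ ≤ K * ENNReal.ofReal ((n : ℝ) ^ 2) *
            (energy φ * ∏ j ∈ Finset.range N, (K * ENNReal.ofReal ((n : ℝ) ^ 2) * e j)) * e N := by
          gcongr
        _ = _ := by ring
  have hsum : ∑ j ∈ Finset.range (n ^ 2), e j ≤ energy φ := by
    have hmono : Monotone t := fun i j hij => by
      simp only [ht]
      gcongr
    rw [he, ← lintegral_biUnion_finset]
    · exact setLIntegral_le_lintegral _ _
    · intro i _ j _ hij
      exact (hmono.pairwise_disjoint_on_Ico_succ hij).preimage φ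
    · exact fun j _ => φ.continuous.measurable measurableSet_Ico
  have hlast : t (n ^ 2) = n + 1 := by
    simp only [ht]
    push_cast
    field_simp
    ring
  rw [← hlast]
  refine (hiter _).trans ?_
  gcongr
  refine prod_le_pow_of_sum_le (by finiteness) ?_
  rw [← Finset.mul_sum]
  calc _ ≤ K * ENNReal.ofReal ((n : ℝ) ^ 2) * energy φ := by gcongr
    _ = _ := by
      rw [show ((n : ℝ) ^ 2) = ((n ^ 2 : ℕ) : ℝ) by push_cast; rfl, ENNReal.ofReal_natCast]
      ring

theorem hgrad_neg (f : ℂ → ℝ) : hgrad (fun z => -f z) = hgrad f := by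
  ext z
  rw [hgrad, hgrad, fderiv_fun_neg, ← ofReal_norm, norm_neg, ofReal_norm]

theorem energy_neg (φ : 𝓓(disk, ℝ)) : energy (-φ : 𝓓(disk, ℝ)) = energy φ := by
  rw [energy, energy, ← hgrad_neg φ]
  rfl

theorem exp_sub_one_le (x : ℝ) : Real.exp x - 1 ≤ x * Real.exp x := by
  have h := Real.add_one_le_exp (-x)
  have h1 := mul_le_mul_of_nonneg_right h (Real.exp_pos x).le
  rw [← Real.exp_add, neg_add_cancel, Real.exp_zero] at h1
  linarith

/-- For `|s| < 1` the quadratic term suffices; it must not be a constant, since the total hyperbolic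
area is infinite. For `|s| ≥ 1` the single index `n = ⌊|s|⌋ - 1` suffices, because `|s| ≤ n + 2`. -/
theorem ofReal_exp_sq_sub_one_le {c : ℝ} (hc : 0 ≤ c) (s : ℝ) :
    ENNReal.ofReal (Real.exp (c * s ^ 2) - 1) ≤ ENNReal.ofReal (c * Real.exp c) * ‖s‖ₑ ^ 2 +
      ∑' n : ℕ, {x : ℝ | (n : ℝ) + 1 ≤ |x|}.indicator
        (fun _ => ENNReal.ofReal (Real.exp (c * (n + 2) ^ 2))) s := by
  rcases lt_or_ge |s| 1 with h | h
  · refine le_add_right ?_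
    rw [← ofReal_norm, ← ENNReal.ofReal_pow (norm_nonneg s), ← ENNReal.ofReal_mul (by positivity),
      Real.norm_eq_abs, sq_abs]
    refine ENNReal.ofReal_le_ofReal ((exp_sub_one_le _).trans ?_)
    have h1 : c * s ^ 2 ≤ c := by
      have : s ^ 2 ≤ 1 := (sq_le_one_iff_abs_le_one s).2 h.le
      nlinarith
    have h2 := Real.exp_le_exp.2 h1
    have h3 : 0 ≤ c * s ^ 2 := by positivity
    nlinarith
  · refine le_add_left ?_
    obtain ⟨n, hn⟩ : ∃ n : ℕ, ⌊|s|⌋₊ = n + 1 :=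
      Nat.exists_eq_succ_of_ne_zero (Nat.floor_pos.2 h).ne'
    have h1 : (n : ℝ) + 1 ≤ |s| := by
      have := Nat.floor_le (abs_nonneg s)
      rw [hn] at this
      exact_mod_cast this
    have h2 : |s| ≤ n + 2 := by
      have := (Nat.lt_floor_add_one |s|).le
      rw [hn] at this
      push_cast at this
      linarith
    refine le_trans ?_ (ENNReal.le_tsum n)
    rw [indicator_of_mem (by exact h1)]
    refine ENNReal.ofReal_le_ofReal ?_
    have h3 : c * s ^ 2 ≤ c * (n + 2) ^ 2 := by
      rw [← sq_abs]
      gcongr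
    linarith [Real.exp_le_exp.2 h3]

/-- A Moser–Trudinger inequality with an unspecified small energy threshold. -/
theorem exists_lintegral_exp_le_of_energy_le {c : ℝ} (hc : 0 ≤ c) :
    ∃ δ B : ℝ≥0∞, 0 < δ ∧ B ≠ ⊤ ∧ ∀ φ : 𝓓(disk, ℝ), energy φ ≤ δ →
      ∫⁻ z, ENNReal.ofReal (Real.exp (c * φ z ^ 2) - 1) ∂hyp ≤ B := by
  obtain ⟨K, hK, hlev⟩ := exists_measure_level_set_le
  -- The rate `2c + 1` beats the growth of `exp (c (n + 2)²)`, since `(n + 2)² = 2n² + 8 - (n - 2)²`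
  -- leaves at most `exp (8c - n²)`, which is at most `exp (8c - n)`.
  set q := ENNReal.ofReal (Real.exp (-(2 * c + 1))) with hq
  set a : ℕ → ℝ := fun n => Real.exp (8 * c) * Real.exp (-1) ^ n with ha
  have hasum : Summable a :=
    (summable_geometric_of_lt_one (Real.exp_pos _).le (by simp)).mul_left _
  have hq0 : 0 < q := by simp [hq, Real.exp_pos]
  refine ⟨min 1 (q / (K + 1)),
    ENNReal.ofReal (c * Real.exp c) * 1 + ∑' n, 2 * ENNReal.ofReal (a n), ?_, ?_, ?_⟩
  · exact lt_min one_pos (ENNReal.div_pos hq0.ne' (by finiteness))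
  · rw [ENNReal.tsum_mul_left]
    have := hasum.tsum_ofReal_ne_top
    finiteness
  intro φ hφ
  have hE1 : energy φ ≤ 1 := hφ.trans (min_le_left _ _)
  have hE2 : K * energy φ ≤ q := by
    calc K * energy φ ≤ (K + 1) * (q / (K + 1)) := by
          gcongr
          · exact le_self_add
          · exact hφ.trans (min_le_right _ _)
      _ ≤ q := ENNReal.mul_div_le
  have hE : energy φ ≠ ⊤ := (hE1.trans_lt ENNReal.one_lt_top).ne
  have hset : ∀ n : ℕ, hyp {z | (n : ℝ) + 1 ≤ |φ z|} ≤ 2 * q ^ (n ^ 2) := by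
    intro n
    have h1 := hlev φ hE n
    have h2 := hlev (-φ) (by rwa [energy_neg]) n
    rw [energy_neg] at h2
    have h3 : {z | (n : ℝ) + 1 ≤ |φ z|} ⊆
        {z | (n : ℝ) + 1 ≤ φ z} ∪ {z | (n : ℝ) + 1 ≤ (-φ : 𝓓(disk, ℝ)) z} := fun z hz =>
      le_abs.1 (show (n : ℝ) + 1 ≤ |φ z| from hz)
    refine (measure_mono h3).trans ((measure_union_le _ _).trans ((add_le_add h1 h2).trans ?_))
    rw [← two_mul]
    gcongr
    exact (mul_le_mul' hE1 (pow_le_pow_left' hE2 _)).trans (one_mul _).le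
  have hm : Measurable φ := φ.continuous.measurable
  have hms : ∀ n : ℕ, MeasurableSet {x : ℝ | (n : ℝ) + 1 ≤ |x|} := fun n =>
    measurableSet_le measurable_const continuous_abs.measurable
  calc ∫⁻ z, ENNReal.ofReal (Real.exp (c * φ z ^ 2) - 1) ∂hyp
      ≤ ∫⁻ z, (ENNReal.ofReal (c * Real.exp c) * ‖φ z‖ₑ ^ 2 +
          ∑' n : ℕ, {x : ℝ | (n : ℝ) + 1 ≤ |x|}.indicator
            (fun _ => ENNReal.ofReal (Real.exp (c * (n + 2) ^ 2))) (φ z)) ∂hyp :=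
        lintegral_mono fun z => ofReal_exp_sq_sub_one_le hc _
    _ = ENNReal.ofReal (c * Real.exp c) * ∫⁻ z, ‖φ z‖ₑ ^ 2 ∂hyp +
          ∑' n : ℕ, ENNReal.ofReal (Real.exp (c * (n + 2) ^ 2)) *
            hyp {z | (n : ℝ) + 1 ≤ |φ z|} := by
        rw [lintegral_add_left (by fun_prop), lintegral_const_mul _ (by fun_prop), lintegral_tsum]
        · congr 2
          ext n
          exact (lintegral_indicator_const (hm (hms n)) _)
        · exact fun n => ((measurable_const.indicator (hms n)).comp hm).aemeasurable
    _ ≤ _ := by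
        refine add_le_add (mul_le_mul_right ((lintegral_sq_le_energy φ).trans hE1) _)
          (ENNReal.tsum_le_tsum fun n => ?_)
        · refine (mul_le_mul_right (hset n) _).trans ?_
          rw [mul_left_comm]
          gcongr
          rw [hq, ← ENNReal.ofReal_pow (Real.exp_pos _).le,
            ← ENNReal.ofReal_mul (Real.exp_pos _).le]
          refine ENNReal.ofReal_le_ofReal ?_
          simp only [ha]
          rw [← Real.exp_nat_mul, ← Real.exp_nat_mul, ← Real.exp_add, ← Real.exp_add]
          refine Real.exp_le_exp.2 ?_
          have h1 : (n : ℝ) ≤ (n : ℝ) ^ 2 := by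
            exact_mod_cast Nat.le_self_pow two_ne_zero n
          push_cast
          nlinarith [mul_nonneg hc (sq_nonneg ((n : ℝ) - 2))]

/-! ### Approximation by test functions, and the pullback on `H01` -/

theorem lintegral_enorm_sq_eq {α E : Type*} [MeasurableSpace α] {μ : Measure α}
    [NormedAddCommGroup E] (f : α → E) : ∫⁻ x, ‖f x‖ₑ ^ 2 ∂μ = eLpNorm f 2 μ ^ 2 := by
  rw [eLpNorm_eq_lintegral_rpow_enorm_toReal two_ne_zero ENNReal.ofNat_ne_top,
    ← ENNReal.rpow_ofNat, ← ENNReal.rpow_mul]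
  simp

theorem enorm_testPair_sq (φ : 𝓓(disk, ℝ)) :
    ‖testPair φ‖ₑ ^ 2 = (∫⁻ z in (disk : Set ℂ), ‖φ z‖ₑ ^ 2) + energy φ := by
  have h := WithLp.prod_norm_sq_eq_of_L2 (testPair φ)
  have h1 : ‖(testPair φ).fst‖ₑ ^ 2 = ∫⁻ z in (disk : Set ℂ), ‖φ z‖ₑ ^ 2 := by
    rw [lintegral_enorm_sq_eq]
    exact congrArg (· ^ 2) (Lp.enorm_toLp (testFunction_memLp φ))
  have h2 : ‖(testPair φ).snd‖ₑ ^ 2 = energy φ := by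
    rw [energy_eq]
    refine (congrArg (· ^ 2) (Lp.enorm_toLp (testFunction_gradient_memLp φ))).trans ?_
    rw [← lintegral_enorm_sq_eq]
    refine lintegral_congr fun z => ?_
    rw [← ofReal_norm, ← ofReal_norm, gradient, LinearIsometryEquiv.norm_map]
  rw [← h1, ← h2, ← ofReal_norm, ← ofReal_norm, ← ofReal_norm, ← ENNReal.ofReal_pow (by positivity),
    h, ENNReal.ofReal_add (by positivity) (by positivity), ENNReal.ofReal_pow (by positivity),
    ENNReal.ofReal_pow (by positivity)]

theorem energy_le_enorm_testPair_sq (φ : 𝓓(disk, ℝ)) : energy φ ≤ ‖testPair φ‖ₑ ^ 2 := by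
  rw [enorm_testPair_sq]
  exact le_add_self

/-- By the Hardy inequality the energy alone controls the `H¹` norm. This is what bounds Möbius
pullbacks, which need not preserve the Euclidean `L²` norm. -/
theorem enorm_testPair_sq_le (φ : 𝓓(disk, ℝ)) : ‖testPair φ‖ₑ ^ 2 ≤ 2 * energy φ := by
  rw [enorm_testPair_sq, two_mul]
  gcongr
  exact (lintegral_disk_le_lintegral_hyp _).trans (lintegral_sq_le_energy φ)

theorem energy_ne_top (φ : 𝓓(disk, ℝ)) : energy φ ≠ ⊤ :=
  ((energy_le_enorm_testPair_sq φ).trans_lt (by finiteness)).ne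

theorem testPair_fst_ae (φ : 𝓓(disk, ℝ)) :
    (((testPair φ).fst : Lp ℝ 2 diskMeasure) : ℂ → ℝ) =ᵐ[diskMeasure] φ :=
  (testFunction_memLp φ).coeFn_toLp

theorem testPair_snd_ae (φ : 𝓓(disk, ℝ)) :
    (((testPair φ).snd : Lp ℂ 2 diskMeasure) : ℂ → ℂ) =ᵐ[diskMeasure] gradient (φ : ℂ → ℝ) :=
  (testFunction_gradient_memLp φ).coeFn_toLp

theorem exists_subseq_tendsto_ae {φ : ℕ → 𝓓(disk, ℝ)} {p : PairSpace}
    (h : Tendsto (fun n => testPair (φ n)) atTop (𝓝 p)) : ∃ ns : ℕ → ℕ, StrictMono ns ∧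
      ∀ᵐ z ∂diskMeasure, Tendsto (fun i => φ (ns i) z) atTop
        (𝓝 ((p.fst : Lp ℝ 2 diskMeasure) z)) := by
  have h1 : Tendsto (fun n => (testPair (φ n)).fst) atTop (𝓝 p.fst) :=
    (continuous_fst.comp (WithLp.prod_continuous_ofLp 2 _ _)).continuousAt.tendsto.comp h
  obtain ⟨ns, hns, hae⟩ := (tendstoInMeasure_of_tendsto_Lp h1).exists_seq_tendsto_ae
  refine ⟨ns, hns, ?_⟩
  filter_upwards [hae, ae_all_iff.2 fun i => testPair_fst_ae (φ (ns i))] with z hz hz'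
  simpa only [hz'] using hz

theorem exists_seq_testFunction (u : H01) : ∃ φ : ℕ → 𝓓(disk, ℝ),
    Tendsto (fun n => testPair (φ n)) atTop (𝓝 (u : PairSpace)) ∧
      ∀ᵐ z ∂diskMeasure, Tendsto (fun n => φ n z) atTop (𝓝 (fn u z)) := by
  have hu : (u : PairSpace) ∈ closure (LinearMap.range testPair : Set PairSpace) := u.2
  obtain ⟨p, hp, hpu⟩ := mem_closure_iff_seq_limit.1 hu
  choose φ hφ using hp
  have h1 : Tendsto (fun n => testPair (φ n)) atTop (𝓝 (u : PairSpace)) := by simpa only [hφ]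
  obtain ⟨ns, hns, hae⟩ := exists_subseq_tendsto_ae h1
  exact ⟨φ ∘ ns, h1.comp hns.tendsto_atTop, hae⟩

theorem aestronglyMeasurable_fn (u : H01) : AEStronglyMeasurable (fn u) diskMeasure :=
  Lp.aestronglyMeasurable _

theorem aestronglyMeasurable_fn_hyp (u : H01) : AEStronglyMeasurable (fn u) hyp :=
  (aestronglyMeasurable_fn u).mono_ac hyp_absolutelyContinuous

/-! ### Exponential integrability and Möbius pullback on the Sobolev space -/

/-- Comes from `s² ≤ 2t² + 2(s - t)²`. With `t` a test function and `s - t` of small energy, both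
terms on the right are integrable for `hyp`. -/
theorem exp_sq_sub_one_le_of_abs_le {c : ℝ} (hc : 0 ≤ c) {s t M : ℝ} (ht : |t| ≤ M) :
    Real.exp (c * s ^ 2) - 1 ≤ Real.exp (2 * c * M ^ 2) * (Real.exp (2 * c * (s - t) ^ 2) - 1) +
      2 * c * Real.exp (2 * c * M ^ 2) * t ^ 2 := by
  have h1 : c * s ^ 2 ≤ 2 * c * t ^ 2 + 2 * c * (s - t) ^ 2 := by
    nlinarith [mul_nonneg hc (sq_nonneg (s - 2 * t))]
  have h2 := Real.exp_le_exp.2 h1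
  rw [Real.exp_add] at h2
  have h3 : t ^ 2 ≤ M ^ 2 := sq_le_sq' (by linarith [abs_le.1 ht]) (abs_le.1 ht).2
  have h4 : Real.exp (2 * c * t ^ 2) ≤ Real.exp (2 * c * M ^ 2) := Real.exp_le_exp.2 (by gcongr)
  have h5 := exp_sub_one_le (2 * c * t ^ 2)
  have h6 : 1 ≤ Real.exp (2 * c * (s - t) ^ 2) := Real.one_le_exp (by positivity)
  have h7 := mul_le_mul_of_nonneg_right h4 (sub_nonneg.2 h6)
  have h8 := mul_le_mul_of_nonneg_left h4 (show 0 ≤ 2 * c * t ^ 2 by positivity)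
  nlinarith

/-- Every exponential of the square of a function in `H01` is integrable for hyperbolic area. -/
theorem integrable_exp_sq_sub_one (u : H01) {c : ℝ} (hc : 0 ≤ c) :
    Integrable (fun z => Real.exp (c * fn u z ^ 2) - 1) hyp := by
  obtain ⟨δ, B, hδ, hB, hbound⟩ := exists_lintegral_exp_le_of_energy_le
    (show 0 ≤ 2 * c by positivity)
  obtain ⟨φ, hφ, hae⟩ := exists_seq_testFunction u
  obtain ⟨N, hN⟩ : ∃ N, ∀ n, N ≤ n → energy (φ n - φ N : 𝓓(disk, ℝ)) ≤ δ := by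
    have hcau := hφ.cauchySeq
    -- A distance below both `δ` and `1` has square at most `δ`, and the squared norm dominates the
    -- energy.
    obtain ⟨N, hN⟩ := EMetric.cauchySeq_iff'.1 hcau (min δ 1) (by simp [hδ])
    refine ⟨N, fun n hn => (energy_le_enorm_testPair_sq _).trans ?_⟩
    have h1 := (hN n hn).le
    rw [edist_eq_enorm_sub, ← map_sub] at h1
    calc ‖testPair (φ n - φ N)‖ₑ ^ 2 ≤ δ * 1 := by
          rw [sq]
          exact mul_le_mul' (h1.trans (min_le_left _ _)) (h1.trans (min_le_right _ _))
      _ = δ := mul_one _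
  set ψ := φ N with hψ
  obtain ⟨M, hM⟩ := ψ.continuous.bounded_above_of_compact_support ψ.hasCompactSupport
  have hmu := (aestronglyMeasurable_fn_hyp u).aemeasurable
  have hmψ : Measurable ψ := ψ.continuous.measurable
  -- The small-energy bound is uniform over the differences `φ n - ψ` with `n ≥ N`; Fatou's lemma
  -- passes it to `u - ψ`.
  have hfatou : ∫⁻ z, ENNReal.ofReal (Real.exp (2 * c * (fn u z - ψ z) ^ 2) - 1) ∂hyp ≤ B := by
    have hlim : ∀ᵐ z ∂hyp, Tendsto
        (fun n => ENNReal.ofReal (Real.exp (2 * c * ((φ n - ψ : 𝓓(disk, ℝ)) z) ^ 2) - 1)) atTop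
        (𝓝 (ENNReal.ofReal (Real.exp (2 * c * (fn u z - ψ z) ^ 2) - 1))) := by
      filter_upwards [hyp_absolutelyContinuous.ae_le hae] with z hz
      have hcont : Continuous fun s : ℝ =>
          ENNReal.ofReal (Real.exp (2 * c * (s - ψ z) ^ 2) - 1) :=
        ENNReal.continuous_ofReal.comp (by fun_prop)
      exact (hcont.tendsto _).comp hz
    calc _ = ∫⁻ z, liminf (fun n => ENNReal.ofReal
            (Real.exp (2 * c * ((φ n - ψ : 𝓓(disk, ℝ)) z) ^ 2) - 1)) atTop ∂hyp :=
          lintegral_congr_ae (hlim.mono fun z hz => hz.liminf_eq.symm)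
      _ ≤ liminf (fun n => ∫⁻ z, ENNReal.ofReal
            (Real.exp (2 * c * ((φ n - ψ : 𝓓(disk, ℝ)) z) ^ 2) - 1) ∂hyp) atTop := by
          refine lintegral_liminf_le fun n => ?_
          have := (φ n - ψ : 𝓓(disk, ℝ)).continuous.measurable
          fun_prop
      _ ≤ B := by
          refine liminf_le_of_frequently_le' (Eventually.frequently ?_)
          filter_upwards [eventually_ge_atTop N] with n hn using hbound _ (hN n hn)
  refine ⟨by fun_prop, ?_⟩
  rw [hasFiniteIntegral_iff_ofReal (Eventually.of_forall fun z => sub_nonneg.2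
    (Real.one_le_exp (by positivity)))]
  calc ∫⁻ z, ENNReal.ofReal (Real.exp (c * fn u z ^ 2) - 1) ∂hyp
      ≤ ∫⁻ z, (ENNReal.ofReal (Real.exp (2 * c * M ^ 2)) *
            ENNReal.ofReal (Real.exp (2 * c * (fn u z - ψ z) ^ 2) - 1) +
          ENNReal.ofReal (2 * c * Real.exp (2 * c * M ^ 2)) * ‖ψ z‖ₑ ^ 2) ∂hyp := by
        refine lintegral_mono fun z => ?_
        rw [← ofReal_norm, ← ENNReal.ofReal_pow (norm_nonneg _), Real.norm_eq_abs, sq_abs,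
          ← ENNReal.ofReal_mul (by positivity), ← ENNReal.ofReal_mul (by positivity),
          ← ENNReal.ofReal_add _ (by positivity)]
        · exact ENNReal.ofReal_le_ofReal (exp_sq_sub_one_le_of_abs_le hc (hM z))
        · exact mul_nonneg (Real.exp_pos _).le (sub_nonneg.2 (Real.one_le_exp (by positivity)))
    _ = ENNReal.ofReal (Real.exp (2 * c * M ^ 2)) *
          ∫⁻ z, ENNReal.ofReal (Real.exp (2 * c * (fn u z - ψ z) ^ 2) - 1) ∂hyp +
        ENNReal.ofReal (2 * c * Real.exp (2 * c * M ^ 2)) * ∫⁻ z, ‖ψ z‖ₑ ^ 2 ∂hyp := by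
        rw [lintegral_add_right _ (by fun_prop), lintegral_const_mul' _ _ (by finiteness),
          lintegral_const_mul' _ _ (by finiteness)]
    _ < ⊤ := by
        have h1 := (hfatou.trans_lt hB.lt_top).ne
        have h2 := ((lintegral_sq_le_energy ψ).trans_lt (energy_ne_top ψ).lt_top).ne
        finiteness

theorem integrableOn_density (u : H01) : IntegrableOn (density (fn u)) (disk : Set ℂ) := by
  have h := integrable_hyp_iff.1 (integrable_exp_sq_sub_one u
    (show 0 ≤ 4 * Real.pi by positivity))
  have he : density (fn u) = fun z => hypWeight z * (Real.exp (4 * Real.pi * fn u z ^ 2) - 1) :=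
    funext fun z => div_eq_inv_mul _ _
  rwa [he]

/-- Pullback of test functions does not increase the energy, so it at most doubles the `H¹` norm and
keeps an approximating sequence Cauchy. The limit is identified through almost-everywhere
convergence along a subsequence. -/
theorem exists_fn_eq_comp_eta {ζ : ℂ} (hζ : ζ ∈ disk) (u : H01) :
    ∃ v : H01, fn v =ᵐ[diskMeasure] fun z => fn u (eta ζ z) := by
  obtain ⟨φ, hφ, hae⟩ := exists_seq_testFunction u
  have hcau : CauchySeq fun n => testPair (pullback hζ (φ n)) := by
    have h1 := hφ.cauchySeq
    rw [EMetric.cauchySeq_iff] at h1 ⊢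
    intro ε hε
    obtain ⟨N, hN⟩ := h1 (ε / 2) (ENNReal.half_pos hε.ne')
    refine ⟨N, fun m hm n hn => ?_⟩
    have h2 := hN m hm n hn
    rw [edist_eq_enorm_sub, ← map_sub] at h2 ⊢
    rw [← pullback_sub]
    have h3 : ‖testPair (pullback hζ (φ m - φ n))‖ₑ ^ 2 ≤
        (2 * ‖testPair (φ m - φ n)‖ₑ) ^ 2 := by
      calc _ ≤ 2 * energy (pullback hζ (φ m - φ n)) := enorm_testPair_sq_le _
        _ ≤ 2 * energy (φ m - φ n : 𝓓(disk, ℝ)) := by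
          gcongr
          exact energy_pullback_le hζ _
        _ ≤ 4 * ‖testPair (φ m - φ n)‖ₑ ^ 2 := by
          gcongr
          · norm_num
          · exact energy_le_enorm_testPair_sq _
        _ = _ := by rw [mul_pow]; norm_num
    refine ((ENNReal.pow_le_pow_left_iff two_ne_zero).1 h3).trans_lt ?_
    have h4 := ENNReal.mul_lt_mul_right two_ne_zero ENNReal.ofNat_ne_top h2
    rwa [ENNReal.mul_div_cancel two_ne_zero ENNReal.ofNat_ne_top] at h4
  obtain ⟨p, hp⟩ := cauchySeq_tendsto_of_complete hcau
  have hmem : p ∈ H01 := mem_closure_of_tendsto hp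
    (Eventually.of_forall fun n => LinearMap.mem_range_self testPair _)
  refine ⟨⟨p, hmem⟩, ?_⟩
  obtain ⟨ns, hns, hae'⟩ := exists_subseq_tendsto_ae hp
  filter_upwards [hae', (quasiMeasurePreserving_eta hζ).ae hae,
    ae_restrict_mem measurableSet_disk] with z h1 h2 hz
  refine tendsto_nhds_unique h1 ?_
  simp only [pullback_apply hζ hz]
  exact h2.comp hns.tendsto_atTop

theorem J_congr_ae {f g : ℂ → ℝ} (h : f =ᵐ[diskMeasure] g) : J f = J g := by
  refine integral_congr_ae ?_
  filter_upwards [h] with z hz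
  rw [density, density, hz]

theorem J_comp_eta {ζ : ℂ} (hζ : ζ ∈ disk) {f : ℂ → ℝ} (hf : AEStronglyMeasurable f hyp) :
    J (fun z => f (eta ζ z)) = J f := by
  have hm := measurePreserving_eta hζ
  rw [J_eq_integral_hyp, J_eq_integral_hyp]
  have h := integral_map (μ := hyp) hm.aemeasurable
    (f := fun z => Real.exp (4 * Real.pi * f z ^ 2) - 1) (by rw [hm.map_eq]; fun_prop)
  rw [hm.map_eq] at h
  exact h.symm

/-! ### Weak convergence to zero of concentrating sequences -/

/-- Cauchy–Schwarz bounds the pairing by the norm of `F k` times the `L²` norm of `G` on the support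
of `F k`. The latter tends to zero by dominated convergence. -/
theorem tendsto_inner_zero_of_eventually_eq_zero {α E : Type*} [MeasurableSpace α] {μ : Measure α}
    [NormedAddCommGroup E] [InnerProductSpace ℝ E] {F : ℕ → Lp E 2 μ} {C : ℝ≥0∞} (hC : C ≠ ⊤)
    (hF : ∀ k, ‖F k‖ₑ ^ 2 ≤ C) (h0 : ∀ᵐ x ∂μ, ∀ᶠ k in atTop, F k x = 0) (G : Lp E 2 μ) :
    Tendsto (fun k => inner ℝ (F k) G) atTop (𝓝 0) := by
  have hG : Measurable fun x => ‖G x‖ₑ := (Lp.stronglyMeasurable G).enorm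
  have hGi : ∫⁻ x, ‖G x‖ₑ ^ 2 ∂μ ≠ ⊤ := by
    rw [lintegral_enorm_sq_eq]
    exact ENNReal.pow_ne_top (Lp.eLpNorm_ne_top G)
  set g : ℕ → α → ℝ≥0∞ := fun k => (Function.support (F k)).indicator fun x => ‖G x‖ₑ
  have hgm : ∀ k, Measurable (g k) := fun k =>
    hG.indicator (Lp.stronglyMeasurable (F k)).measurableSet_support
  have hbound : ∀ k, ‖inner ℝ (F k) G‖ₑ ^ 2 ≤ C * ∫⁻ x, g k x ^ 2 ∂μ := by
    intro k
    have hFm : Measurable fun x => ‖F k x‖ₑ := (Lp.stronglyMeasurable (F k)).enorm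
    rw [L2.inner_def]
    calc _ ≤ (∫⁻ x, ‖F k x‖ₑ * g k x ∂μ) ^ 2 := by
          gcongr
          refine (enorm_integral_le_lintegral_enorm _).trans (lintegral_mono fun x => ?_)
          by_cases hx : F k x = 0
          · simp [hx]
          · have hx' : x ∈ Function.support (F k) := hx
            simp only [g, indicator_of_mem hx', ← ofReal_norm]
            rw [← ENNReal.ofReal_mul (norm_nonneg _)]
            exact ENNReal.ofReal_le_ofReal (norm_inner_le_norm _ _)
      _ ≤ (∫⁻ x, ‖F k x‖ₑ ^ 2 ∂μ) * ∫⁻ x, g k x ^ 2 ∂μ :=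
          sq_lintegral_mul_le hFm.aemeasurable (hgm k).aemeasurable
      _ ≤ _ := by
          gcongr
          rw [lintegral_enorm_sq_eq, ← Lp.enorm_def]
          exact hF k
  have hlim : Tendsto (fun k => ∫⁻ x, g k x ^ 2 ∂μ) atTop (𝓝 0) := by
    have h := tendsto_lintegral_of_dominated_convergence (μ := μ) (F := fun k x => g k x ^ 2)
      (f := fun _ => 0) (fun x => ‖G x‖ₑ ^ 2) (fun k => (hgm k).pow_const 2)
      (fun k => Eventually.of_forall fun x => by
        exact pow_le_pow_left' (indicator_le_self _ _ x) 2) hGi ?_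
    · simpa using h
    · filter_upwards [h0] with x hx
      refine tendsto_const_nhds.congr' ?_
      filter_upwards [hx] with k hk
      simp [g, hk]
  have h1 : Tendsto (fun k => C * ∫⁻ x, g k x ^ 2 ∂μ) atTop (𝓝 0) := by
    simpa using ENNReal.Tendsto.const_mul hlim (Or.inr hC)
  have h2 : Tendsto (fun k => ‖inner ℝ (F k) G‖ₑ ^ 2) atTop (𝓝 0) :=
    tendsto_of_tendsto_of_tendsto_of_le_of_le tendsto_const_nhds h1 (fun _ => zero_le) hbound
  rw [tendsto_zero_iff_norm_tendsto_zero]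
  have h3 := (ENNReal.tendsto_toReal ENNReal.zero_ne_top).comp h2
  have h4 := (Real.continuous_sqrt.tendsto _).comp h3
  simpa [Function.comp_def, Real.sqrt_sq_eq_abs] using h4

/-- The element of `H01` given by a test function. -/
def ofTest (φ : 𝓓(disk, ℝ)) : H01 :=
  ⟨testPair φ, subset_closure (LinearMap.mem_range_self testPair φ)⟩

theorem fn_ofTest_ae (φ : 𝓓(disk, ℝ)) : fn (ofTest φ) =ᵐ[diskMeasure] φ := testPair_fst_ae φ

theorem fn_add_ae (u v : H01) : fn (u + v) =ᵐ[diskMeasure] fun z => fn u z + fn v z :=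
  Lp.coeFn_add _ _

instance : CompleteSpace H01 :=
  (Submodule.isClosed_topologicalClosure (LinearMap.range testPair)).completeSpace_coe

/-- By Riesz representation, every continuous functional is an inner product with a fixed vector.
Injectivity of the pairing permits testing weak limits by evaluation. -/
theorem weaklyConverges_of_inner {U : ℕ → H01} {u : H01}
    (h : ∀ v : H01, Tendsto (fun k => inner ℝ v (U k)) atTop (𝓝 (inner ℝ v u))) :
    WeaklyConverges U u := by
  have hinj : Function.Injective (topDualPairing ℝ H01).flip := by
    intro x y hxy
    refine ext_inner_left ℝ fun v => ?_
    exact LinearMap.congr_fun hxy (InnerProductSpace.toDual ℝ H01 v)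
  refine (WeakBilin.tendsto_iff_forall_eval_tendsto _ hinj).2 fun ℓ => ?_
  have h1 := h ((InnerProductSpace.toDual ℝ H01).symm ℓ)
  simp only [InnerProductSpace.toDual_symm_apply] at h1
  exact h1

theorem tendsto_eta_of_tendsto_one {ζ : ℕ → ℂ} (h : Tendsto ζ atTop (𝓝 1)) {z : ℂ}
    (hz : z ∈ disk) : Tendsto (fun k => eta (ζ k) z) atTop (𝓝 (-1)) := by
  have hne : (1 : ℂ) - z ≠ 0 := by
    intro h0
    have := mem_disk.1 hz
    rw [← sub_eq_zero.1 h0] at this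
    simp at this
  have h1 : Tendsto (fun k => z - ζ k) atTop (𝓝 (z - 1)) := tendsto_const_nhds.sub h
  have h2 : Tendsto (fun k => 1 - conj (ζ k) * z) atTop (𝓝 (1 - conj 1 * z)) :=
    tendsto_const_nhds.sub (((Complex.continuous_conj.tendsto _).comp h).mul tendsto_const_nhds)
  rw [map_one, one_mul] at h2
  have h3 : (z - 1) / (1 - z) = -1 := by
    rw [div_eq_iff hne]
    ring
  rw [← h3]
  exact h1.div h2 hne

/-- The limit point `-1` lies on the unit circle, outside the closed support of `w`. -/
theorem eventually_eta_notMem_tsupport {ζ : ℕ → ℂ} (h : Tendsto ζ atTop (𝓝 1))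
    (w : 𝓓(disk, ℝ)) {z : ℂ} (hz : z ∈ disk) : ∀ᶠ k in atTop, eta (ζ k) z ∉ tsupport w := by
  refine (tendsto_eta_of_tendsto_one h hz).eventually
    ((isClosed_tsupport w).isOpen_compl.mem_nhds fun h1 => ?_)
  simpa using mem_disk.1 (w.tsupport_subset h1)

theorem gradient_pullback_eq_zero {ζ z : ℂ} (hζ : ζ ∈ disk) (hz : z ∈ disk) (w : 𝓓(disk, ℝ))
    (h : eta ζ z ∉ tsupport w) : gradient (pullback hζ w : ℂ → ℝ) z = 0 := by
  have h1 := hgrad_pullback_le hζ hz w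
  have h2 : hgrad w (eta ζ z) = 0 := by
    rw [hgrad, fderiv_of_notMem_tsupport (𝕜 := ℝ) h, ← ofReal_norm, norm_zero,
      ENNReal.ofReal_zero, mul_zero]
  rw [h2, nonpos_iff_eq_zero, hgrad, mul_eq_zero] at h1
  rcases h1 with h1 | h1
  · exact absurd h1 (by simpa using one_sub_norm_sq_pos hz)
  · rw [← ofReal_norm, ENNReal.ofReal_eq_zero, norm_le_zero_iff] at h1
    rw [gradient, h1, map_zero]

theorem weaklyConverges_add_pullback {ζ : ℕ → ℂ} (hζ : ∀ k, ζ k ∈ disk)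
    (h : Tendsto ζ atTop (𝓝 1)) (w : 𝓓(disk, ℝ)) (u : H01) :
    WeaklyConverges (fun k => u + ofTest (pullback (hζ k) w)) u := by
  refine weaklyConverges_of_inner fun v => ?_
  set P : ℕ → PairSpace := fun k => testPair (pullback (hζ k) w)
  have hP : ∀ k, ‖P k‖ₑ ^ 2 ≤ 2 * energy w := fun k => (enorm_testPair_sq_le _).trans (by
    gcongr
    exact energy_pullback_le (hζ k) w)
  have hE : 2 * energy w ≠ ⊤ := ENNReal.mul_ne_top ENNReal.ofNat_ne_top (energy_ne_top w)
  have hnorm : ∀ p : PairSpace, ‖p.fst‖ ≤ ‖p‖ ∧ ‖p.snd‖ ≤ ‖p‖ := fun p =>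
    ⟨WithLp.norm_fst_le _ p, WithLp.norm_snd_le _ p⟩
  have h1 : Tendsto (fun k => inner ℝ (P k).fst (v : PairSpace).fst) atTop (𝓝 0) := by
    refine tendsto_inner_zero_of_eventually_eq_zero hE (fun k => le_trans ?_ (hP k)) ?_ _
    · gcongr
      exact enorm_le_iff_norm_le.2 (hnorm _).1
    · filter_upwards [ae_all_iff.2 fun k => testPair_fst_ae (pullback (hζ k) w),
        ae_restrict_mem measurableSet_disk] with z hz hzd
      filter_upwards [eventually_eta_notMem_tsupport h w hzd] with k hk
      rw [hz k, pullback_apply (hζ k) hzd, image_eq_zero_of_notMem_tsupport hk]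
  have h2 : Tendsto (fun k => inner ℝ (P k).snd (v : PairSpace).snd) atTop (𝓝 0) := by
    refine tendsto_inner_zero_of_eventually_eq_zero hE (fun k => le_trans ?_ (hP k)) ?_ _
    · gcongr
      exact enorm_le_iff_norm_le.2 (hnorm _).2
    · filter_upwards [ae_all_iff.2 fun k => testPair_snd_ae (pullback (hζ k) w),
        ae_restrict_mem measurableSet_disk] with z hz hzd
      filter_upwards [eventually_eta_notMem_tsupport h w hzd] with k hk
      rw [hz k, gradient_pullback_eq_zero (hζ k) hzd w hk]
  have h3 : ∀ k, inner ℝ v (u + ofTest (pullback (hζ k) w)) = inner ℝ v u +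
      (inner ℝ (P k).fst (v : PairSpace).fst + inner ℝ (P k).snd (v : PairSpace).snd) := by
    intro k
    rw [inner_add_right, real_inner_comm (ofTest (pullback (hζ k) w)) v, Submodule.coe_inner]
    rfl
  simp only [h3]
  simpa using (h1.add h2).const_add (inner ℝ v u)

/-! ### Splitting of `J` along concentrating sequences -/

/-- The defect of additivity of `s ↦ exp (4π s²) - 1`. -/
def splitDefect (a b : ℝ) : ℝ :=
  (Real.exp (4 * Real.pi * (a + b) ^ 2) - 1) - (Real.exp (4 * Real.pi * a ^ 2) - 1) -
    (Real.exp (4 * Real.pi * b ^ 2) - 1)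

theorem splitDefect_zero_right (a : ℝ) : splitDefect a 0 = 0 := by
  simp [splitDefect]

theorem abs_exp_sub_one_le (y : ℝ) : |Real.exp y - 1| ≤ Real.exp |y| - 1 := by
  rcases le_total 0 y with h | h
  · rw [abs_of_nonneg h, abs_of_nonneg (sub_nonneg.2 (Real.one_le_exp h))]
  · rw [abs_of_nonpos h, abs_of_nonpos (sub_nonpos.2 (Real.exp_le_one_iff.2 h))]
    have h1 := Real.add_one_le_exp y
    have h2 := Real.add_one_le_exp (-y)
    linarith

/-- Up to the term `exp (p a²) - 1`, the defect is `exp (p b²)` times `exp y - 1` with `y = p a² +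
2p a b`. The cross term in `y` is split into a small constant and a large multiple of `a²`. The
constant `ε` will be paid only on a set of finite area; the rest is an integrable function of `a =
u`. -/
theorem exists_abs_splitDefect_le (M : ℝ) {ε : ℝ} (hε : 0 < ε) :
    ∃ C c : ℝ, 0 ≤ C ∧ 0 ≤ c ∧ ∀ a b : ℝ, |b| ≤ M →
      |splitDefect a b| ≤ ε + C * (Real.exp (c * a ^ 2) - 1) := by
  set p := 4 * Real.pi with hp
  have hp0 : 0 < p := by positivity
  set D := Real.exp (p * M ^ 2) with hD
  have hD0 : 0 < D := Real.exp_pos _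
  -- Chosen so that `D (exp δ - 1) = ε`.
  set δ := Real.log (1 + ε / D) with hδ
  have hδ0 : 0 < δ := Real.log_pos (by linarith [div_pos hε hD0])
  have hexpδ : Real.exp δ = 1 + ε / D := Real.exp_log (by positivity)
  set c := p + (p * M) ^ 2 / δ with hc
  have hpc : p ≤ c := by linarith [show 0 ≤ (p * M) ^ 2 / δ by positivity]
  refine ⟨D * Real.exp δ + 1, c, by positivity, hp0.le.trans hpc, fun a b hb => ?_⟩
  have hb2 : b ^ 2 ≤ M ^ 2 := sq_le_sq' (by linarith [abs_le.1 hb]) (abs_le.1 hb).2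
  have hid : splitDefect a b = Real.exp (p * b ^ 2) * (Real.exp (p * a ^ 2 + 2 * p * a * b) - 1) -
      (Real.exp (p * a ^ 2) - 1) := by
    rw [splitDefect, mul_sub, ← Real.exp_add, ← hp,
      show p * (a + b) ^ 2 = p * b ^ 2 + (p * a ^ 2 + 2 * p * a * b) by ring]
    ring
  have hy : |p * a ^ 2 + 2 * p * a * b| ≤ δ + c * a ^ 2 := by
    have h1 : |p * a ^ 2 + 2 * p * a * b| ≤ p * a ^ 2 + 2 * p * |a| * M := by
      refine (abs_add_le _ _).trans ?_
      rw [abs_of_nonneg (show 0 ≤ p * a ^ 2 by positivity), abs_mul, abs_mul,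
        abs_of_nonneg (show 0 ≤ 2 * p by positivity)]
      gcongr
    -- Weighted Young inequality, from expanding `(δ - p M |a|)² / δ ≥ 0`.
    have h2 : 2 * p * |a| * M ≤ δ + (p * M) ^ 2 / δ * a ^ 2 := by
      have h3 : 0 ≤ (δ - p * M * |a|) ^ 2 / δ := by positivity
      have h4 : (δ - p * M * |a|) ^ 2 / δ = δ + (p * M) ^ 2 / δ * a ^ 2 - 2 * p * |a| * M := by
        rw [← sq_abs a]
        field_simp
        ring
      linarith
    rw [hc]
    linarith
  have h1 : |Real.exp (p * a ^ 2 + 2 * p * a * b) - 1| ≤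
      Real.exp δ * Real.exp (c * a ^ 2) - 1 := by
    refine (abs_exp_sub_one_le _).trans ?_
    rw [← Real.exp_add]
    exact sub_le_sub_right (Real.exp_le_exp.2 hy) 1
  have h2 : |Real.exp (p * a ^ 2) - 1| ≤ Real.exp (c * a ^ 2) - 1 := by
    rw [abs_of_nonneg (sub_nonneg.2 (Real.one_le_exp (by positivity)))]
    have : p * a ^ 2 ≤ c * a ^ 2 := by gcongr
    linarith [Real.exp_le_exp.2 this]
  have h3 : Real.exp (p * b ^ 2) ≤ D := Real.exp_le_exp.2 (by gcongr)
  have h4 : D * Real.exp δ = D + ε := by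
    rw [hexpδ]
    field_simp
  calc |splitDefect a b|
      ≤ Real.exp (p * b ^ 2) * |Real.exp (p * a ^ 2 + 2 * p * a * b) - 1| +
          |Real.exp (p * a ^ 2) - 1| := by
        rw [hid]
        refine (abs_sub _ _).trans (le_of_eq ?_)
        rw [abs_mul, abs_of_pos (Real.exp_pos _)]
    _ ≤ D * (Real.exp δ * Real.exp (c * a ^ 2) - 1) + (Real.exp (c * a ^ 2) - 1) := by
        gcongr
    _ = ε + (D * Real.exp δ + 1) * (Real.exp (c * a ^ 2) - 1) := by
        linear_combination h4

theorem hyp_tsupport_ne_top (w : 𝓓(disk, ℝ)) : hyp (tsupport w) ≠ ⊤ := by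
  have hK := w.hasCompactSupport.isCompact
  have hcont : ContinuousOn hypWeight (tsupport w) := fun z hz =>
    (((contDiffAt_inv_one_sub_norm_sq (w.tsupport_subset hz)).continuousAt.pow 2).congr
      (Eventually.of_forall fun _ => inv_pow _ _)).continuousWithinAt
  have h1 : IntegrableOn hypWeight (tsupport w) diskMeasure :=
    (hcont.integrableOn_compact hK).mono_measure Measure.restrict_le_self
  rw [hyp, withDensity_apply _ (isClosed_tsupport w).measurableSet]
  exact ((hasFiniteIntegral_iff_ofReal (Eventually.of_forall hypWeight_nonneg)).1
    h1.hasFiniteIntegral).ne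

/-- The defect vanishes off the preimage of the support of `w`. On it the constant part of the bound
contributes at most a small number times a fixed area. The remaining part is a fixed integrable
function on sets that eventually leave each point. -/
theorem tendsto_lintegral_splitDefect {ζ : ℕ → ℂ} (hζ : ∀ k, ζ k ∈ disk)
    (h : Tendsto ζ atTop (𝓝 1)) (w : 𝓓(disk, ℝ)) (u : H01) :
    Tendsto (fun k => ∫⁻ z, ‖splitDefect (fn u z) (w (eta (ζ k) z))‖ₑ ∂hyp) atTop (𝓝 0) := by
  obtain ⟨M, hM⟩ := w.continuous.bounded_above_of_compact_support w.hasCompactSupport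
  have hKm : MeasurableSet (tsupport w) := (isClosed_tsupport w).measurableSet
  rw [ENNReal.tendsto_nhds_zero]
  intro ε hε
  obtain ⟨η, hη, hηε⟩ := ENNReal.exists_nnreal_pos_mul_lt (hyp_tsupport_ne_top w)
    (ENNReal.half_pos hε.ne').ne'
  obtain ⟨C, c, hC, hc, hb⟩ := exists_abs_splitDefect_le M (ε := η) (by exact_mod_cast hη)
  set S : ℕ → Set ℂ := fun k => eta (ζ k) ⁻¹' tsupport w
  have hSm : ∀ k, MeasurableSet (S k) := fun k => measurable_eta _ hKm
  set G : ℂ → ℝ := fun z => C * (Real.exp (c * fn u z ^ 2) - 1)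
  have hG0 : ∀ z, 0 ≤ G z := fun z =>
    mul_nonneg hC (sub_nonneg.2 (Real.one_le_exp (by positivity)))
  have hGi : Integrable G hyp := (integrable_exp_sq_sub_one u hc).const_mul C
  have hGm : AEMeasurable (fun z => ENNReal.ofReal (G z)) hyp := hGi.aemeasurable.ennreal_ofReal
  have hle : ∀ k, ∫⁻ z, ‖splitDefect (fn u z) (w (eta (ζ k) z))‖ₑ ∂hyp ≤
      η * hyp (tsupport w) + ∫⁻ z, (S k).indicator (fun z => ENNReal.ofReal (G z)) z ∂hyp := by
    intro k
    -- By invariance the preimages `S k` all have the hyperbolic area of the support of `w`, so the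
    -- bound is uniform in `k`.
    rw [← (measurePreserving_eta (hζ k)).measure_preimage hKm.nullMeasurableSet,
      ← lintegral_indicator_const (hSm k), ← lintegral_add_left (measurable_const.indicator (hSm k))]
    refine lintegral_mono fun z => ?_
    by_cases hz : z ∈ S k
    · simp only [indicator_of_mem hz]
      rw [← ENNReal.ofReal_coe_nnreal, ← ENNReal.ofReal_add η.coe_nonneg (hG0 z), ← ofReal_norm]
      exact ENNReal.ofReal_le_ofReal (hb _ _ (hM _))
    · have h0 : w (eta (ζ k) z) = 0 := image_eq_zero_of_notMem_tsupport hz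
      simp [h0, splitDefect_zero_right]
  have hlim : Tendsto (fun k => ∫⁻ z, (S k).indicator (fun z => ENNReal.ofReal (G z)) z ∂hyp)
      atTop (𝓝 0) := by
    have h1 := tendsto_lintegral_of_dominated_convergence' (μ := hyp)
      (F := fun k => (S k).indicator fun z => ENNReal.ofReal (G z)) (f := fun _ => 0)
      (fun z => ENNReal.ofReal (G z)) (fun k => hGm.indicator (hSm k))
      (fun k => Eventually.of_forall (indicator_le_self _ _))
      ((hasFiniteIntegral_iff_ofReal (Eventually.of_forall hG0)).1 hGi.hasFiniteIntegral).ne ?_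
    · simpa using h1
    · filter_upwards [ae_hyp_mem_disk] with z hz
      refine tendsto_const_nhds.congr' ?_
      filter_upwards [eventually_eta_notMem_tsupport h w hz] with k hk
      exact (indicator_of_notMem (s := S k) hk _).symm
  filter_upwards [ENNReal.tendsto_nhds_zero.1 hlim (ε / 2) (ENNReal.half_pos hε.ne')] with k hk
  calc _ ≤ _ := hle k
    _ ≤ ε / 2 + ε / 2 := add_le_add hηε.le hk
    _ = ε := ENNReal.add_halves ε

theorem fn_ofTest_pullback_ae {ζ : ℂ} (hζ : ζ ∈ disk) (w : 𝓓(disk, ℝ)) :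
    fn (ofTest (pullback hζ w)) =ᵐ[diskMeasure] fun z => w (eta ζ z) := by
  filter_upwards [fn_ofTest_ae (pullback hζ w), ae_restrict_mem measurableSet_disk] with z hz hzd
  rw [hz, pullback_apply hζ hzd]

/-- By invariance `J (W k) = J w` for every `k`, so the error is exactly the integral of the
splitting defect. -/
theorem tendsto_J_add_pullback {ζ : ℕ → ℂ} (hζ : ∀ k, ζ k ∈ disk)
    (h : Tendsto ζ atTop (𝓝 1)) (w : 𝓓(disk, ℝ)) (u : H01) :
    Tendsto (fun k => J (fn (u + ofTest (pullback (hζ k) w)))) atTop (𝓝 (J (fn u) + J w)) := by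
  set W : ℕ → H01 := fun k => ofTest (pullback (hζ k) w)
  have hp : 0 ≤ 4 * Real.pi := by positivity
  have hW : ∀ k, J (fn (W k)) = J w := fun k =>
    (J_congr_ae (fn_ofTest_pullback_ae (hζ k) w)).trans
      (J_comp_eta (hζ k) w.continuous.aestronglyMeasurable)
  have hdiff : ∀ k, J (fn (u + W k)) - (J (fn u) + J w) =
      ∫ z, splitDefect (fn u z) (w (eta (ζ k) z)) ∂hyp := by
    intro k
    have hsub : Integrable (fun z => (Real.exp (4 * Real.pi * fn (u + W k) z ^ 2) - 1) -
        (Real.exp (4 * Real.pi * fn u z ^ 2) - 1)) hyp :=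
      (integrable_exp_sq_sub_one _ hp).sub (integrable_exp_sq_sub_one _ hp)
    rw [← hW k, J_eq_integral_hyp, J_eq_integral_hyp, J_eq_integral_hyp, ← sub_sub,
      ← integral_sub (integrable_exp_sq_sub_one _ hp) (integrable_exp_sq_sub_one _ hp),
      ← integral_sub hsub (integrable_exp_sq_sub_one _ hp)]
    refine integral_congr_ae ?_
    filter_upwards [hyp_absolutelyContinuous.ae_le (fn_add_ae u (W k)),
      hyp_absolutelyContinuous.ae_le (fn_ofTest_pullback_ae (hζ k) w)] with z h1 h2
    rw [h1, h2, splitDefect]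
  refine tendsto_sub_nhds_zero_iff.1 (Tendsto.congr (fun k => (hdiff k).symm) ?_)
  have h1 := (ENNReal.tendsto_toReal ENNReal.zero_ne_top).comp
    (tendsto_lintegral_splitDefect hζ h w u)
  refine squeeze_zero_norm' ?_ h1
  filter_upwards [ENNReal.tendsto_nhds_zero.1 (tendsto_lintegral_splitDefect hζ h w u) 1 one_pos]
    with k hk
  have h2 := enorm_integral_le_lintegral_enorm (μ := hyp)
    fun z => splitDefect (fn u z) (w (eta (ζ k) z))
  have h3 := ENNReal.toReal_mono (hk.trans_lt ENNReal.one_lt_top).ne h2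
  rwa [toReal_enorm] at h3

/-! ### Positivity of `J` and failure of weak continuity -/

theorem J_pos {w : 𝓓(disk, ℝ)} (hw : w ≠ 0) : 0 < J w := by
  have hp : 0 ≤ 4 * Real.pi := by positivity
  rw [← J_congr_ae (fn_ofTest_ae w), J_eq_integral_hyp,
    integral_pos_iff_support_of_nonneg
      (fun z => sub_nonneg.2 (Real.one_le_exp (by positivity))) (integrable_exp_sq_sub_one _ hp)]
  obtain ⟨z₀, hz₀⟩ : ∃ z, w z ≠ 0 := by
    by_contra! h
    exact hw (by ext z; simpa using h z)
  have hpos : 0 < diskMeasure (Function.support w) := by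
    rw [Measure.restrict_apply w.continuous.isOpen_support.measurableSet,
      inter_eq_left.2 ((subset_tsupport _).trans w.tsupport_subset)]
    exact w.continuous.isOpen_support.measure_pos _ ⟨z₀, hz₀⟩
  rw [pos_iff_ne_zero]
  intro h0
  -- If the integrand vanished `hyp`-almost everywhere, the support of `w`, a nonempty open set,
  -- would be Lebesgue null.
  have h1 := absolutelyContinuous_hyp h0
  refine hpos.ne' (measure_mono_null_ae ?_ h1)
  filter_upwards [fn_ofTest_ae w] with z hz hz'
  change Real.exp (4 * Real.pi * fn (ofTest w) z ^ 2) - 1 ≠ 0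
  rw [hz]
  have : 0 < 4 * Real.pi * w z ^ 2 := by
    have : w z ≠ 0 := hz'
    positivity
  exact (sub_pos.2 (Real.one_lt_exp_iff.2 this)).ne'

theorem exists_testFunction_ne_zero : ∃ w : 𝓓(disk, ℝ), w ≠ 0 := by
  let f : ContDiffBump (0 : ℂ) := ⟨1 / 4, 1 / 2, by norm_num, by norm_num⟩
  refine ⟨⟨f, f.contDiff, f.hasCompactSupport, ?_⟩, fun h => ?_⟩
  · rw [f.tsupport_eq]
    exact Metric.closedBall_subset_ball (by norm_num)
  · have h1 : f 0 = 1 := f.one_of_mem_closedBall (Metric.mem_closedBall_self (by norm_num))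
    have h2 : f 0 = 0 := congrArg (fun w : 𝓓(disk, ℝ) => w 0) h
    exact one_ne_zero (h1.symm.trans h2)

theorem exists_seq_disk_tendsto_one :
    ∃ ζ : ℕ → ℂ, (∀ k, ζ k ∈ disk) ∧ Tendsto ζ atTop (𝓝 1) := by
  refine ⟨fun k => ((1 - 1 / ((k : ℝ) + 1) / 2 : ℝ) : ℂ), fun k => ?_, ?_⟩
  · have h1 : 0 < 1 / ((k : ℝ) + 1) := by positivity
    have h2 : 1 / ((k : ℝ) + 1) ≤ 1 := by
      rw [div_le_one (by positivity)]
      linarith [(Nat.cast_nonneg k : (0 : ℝ) ≤ k)]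
    rw [mem_disk, Complex.norm_real, Real.norm_eq_abs, abs_lt]
    constructor <;> linarith
  · have h1 : Tendsto (fun k : ℕ => 1 - 1 / ((k : ℝ) + 1) / 2) atTop (𝓝 (1 - 0 / 2)) :=
      (tendsto_one_div_add_atTop_nhds_zero_nat.div_const 2).const_sub 1
    have h2 := (Complex.continuous_ofReal.tendsto _).comp h1
    simpa [Function.comp_def] using h2

/-- Continuity along one concentrating sequence would force `J u = J u + J w` with `J w > 0`. -/
theorem not_weaklySeqContinuousAt (u : H01) :
    ¬ WeaklySeqContinuousAt (fun v => J (fn v)) u := by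
  obtain ⟨w, hw⟩ := exists_testFunction_ne_zero
  obtain ⟨ζ, hζ, h⟩ := exists_seq_disk_tendsto_one
  intro hc
  have h1 := hc _ (weaklyConverges_add_pullback hζ h w u)
  have h2 := tendsto_nhds_unique h1 (tendsto_J_add_pullback hζ h w u)
  linarith [J_pos hw]

theorem WeaklyContinuousAt.weaklySeqContinuousAt {F : H01 → ℝ} {u : H01}
    (h : WeaklyContinuousAt F u) : WeaklySeqContinuousAt F u :=
  fun _ hU => h.tendsto.comp hU

end MobiusTM

end

open MobiusTM
theorem mainTheorem4 :
    -- `J` is finite on `H₀¹(𝔻)`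
    (∀ u : H01, IntegrableOn (density (fn u)) (disk : Set ℂ)) ∧
    -- `J` is Möbius invariant
    (∀ ζ ∈ disk, ∀ u : H01, ∃ v : H01,
      fn v =ᵐ[diskMeasure] (fun z => fn u (eta ζ z)) ∧ J (fn v) = J (fn u)) ∧
    -- `J` is weakly continuous at no point, sequentially or topologically
    (∀ u : H01,
      ¬ WeaklySeqContinuousAt (fun v => J (fn v)) u ∧
      ¬ WeaklyContinuousAt (fun v => J (fn v)) u) ∧
    -- the sequences `u + w ∘ η_{ζ_k}` with `ζ_k → 1`
    (∀ w : 𝓓(disk, ℝ), w ≠ 0 →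
      ∀ ζ : ℕ → ℂ, (∀ k, ζ k ∈ disk) → Tendsto ζ atTop (𝓝 1) →
      ∃ W : ℕ → H01,
        (∀ k, fn (W k) =ᵐ[diskMeasure] fun z => w (eta (ζ k) z)) ∧
        ∀ u : H01,
          WeaklyConverges (fun k => u + W k) u ∧
          Tendsto (fun k => J (fn (u + W k))) atTop (𝓝 (J (fn u) + J w)) ∧
          J (fn u) + J w ≠ J (fn u)) := by
  refine ⟨integrableOn_density, fun ζ hζ u => ?_, fun u => ⟨not_weaklySeqContinuousAt u,
    fun h => not_weaklySeqContinuousAt u h.weaklySeqContinuousAt⟩, fun w hw ζ hζ h =>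
    ⟨fun k => ofTest (pullback (hζ k) w), fun k => fn_ofTest_pullback_ae (hζ k) w, fun u =>
    ⟨weaklyConverges_add_pullback hζ h w u, tendsto_J_add_pullback hζ h w u, ?_⟩⟩⟩
  · obtain ⟨v, hv⟩ := exists_fn_eq_comp_eta hζ u
    exact ⟨v, hv, (J_congr_ae hv).trans (J_comp_eta hζ (aestronglyMeasurable_fn_hyp u))⟩
  · exact (lt_add_of_pos_right _ (J_pos hw)).ne'
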